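/- **Model.** For each $r,c\ge 1$ consider an $r\times c$ table with cell counts $K_{ij}\in\{0,1,2,\dots\}$ and set of observed cells $E=\{(i,j):K_{ij}\ge 1\}$. The cell means are $\eta_{ij}=m+\alpha_i+\beta_j$, i.e. $\eta_c=\mathbf 1 m+Z_c\theta\in\mathbb R^{rc}$ with $\theta=(\alpha,\beta)$ and $Z_c=[\,I_r\otimes\mathbf 1_c,\ \mathbf 1_r\otimes I_c\,]$. One observes independent $y_{ij}\sim N(\eta_{ij},\sigma^2/K_{ij})$ for $(i,j)\in E$, with $\sigma>0$ known and not depending on $r,c$. Let $\eta$ and $Z$ consist of the entries of $\eta_c$ and the rows of $Z_c$ indexed by $E$, and let $M=\mathrm{diag}(K_{ij}^{-1})_{(i,j)\in E}$. It is assumed that $\eta_c$ is estimable, i.e. $BZ=Z_c$ for some matrix $B$. All parameters and counts may vary with $(r,c)$. **Estimators.** For $\lambda_A,\lambda_B\ge 0$ put $\Lambda=\mathrm{diag}(\sqrt{\lambda_A}\,I_r,\sqrt{\lambda_B}\,I_c)$, $\Sigma=Z\Lambda\Lambda^{\mathsf T}Z^{\mathsf T}+M$ and $$\hat\eta^{S}(\mu,\lambda_A,\lambda_B)=y-M\Sigma^{-1}(y-\mathbf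 1\mu),$$ where $\Sigma^{-1}$ is extended to $(\lambda_A,\lambda_B)\in[0,\infty]^2$ by continuity. Let $\tilde Z=Z_c$, let $Z^\dagger$ be the Moore–Penrose inverse of $Z$, and let $Q=(\tilde ZZ^\dagger)^{\mathsf T}\tilde ZZ^\dagger$. The loss is $L(\eta_c,\hat\eta_c)=(rc)^{-1}\|\hat\eta_c-\eta_c\|^2$, over all $rc$ cells. Its unbiased risk estimate for $\tilde ZZ^\dagger\hat\eta^S(\mu,\lambda_A,\lambda_B)$ is $$\mathrm{URE}^Q(\mu,\lambda_A,\lambda_B)=\tfrac1{rc}\big\{\sigma^2\mathrm{tr}(QM)-2\sigma^2\mathrm{tr}(\Sigma^{-1}MQM)+(y-\mathbf 1\mu)^{\mathsf T}\Sigma^{-1}MQM\Sigma^{-1}(y-\mathbf 1\mu)\big\}.$$ Fix $\tau\in(0,1]$ and let $\hat a_\tau,\hat b_\tau$ be the $\tau/2$ and $1-\tau/2$ quantiles of the observed values $\{y_{ij}:(i,j)\in E\}$. Hyper-parameter estimates are measurable functions $(\hat\mu,\hat\lambda_A,\hat\lambda_B)$ of the data with values in $\hat T=[\hat a_\tau,\hat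 b_\tau]\times[0,\infty]\times[0,\infty]$. The URE-based estimator is $\hat\eta_c^{\rm URE}=\tilde ZZ^\dagger\hat\eta^S(\hat\mu^{U},\hat\lambda_A^{U},\hat\lambda_B^{U})$, where $(\hat\mu^{U},\hat\lambda_A^{U},\hat\lambda_B^{U})$ are hyper-parameter estimates that minimize $\mathrm{URE}^Q$ over $\hat T$. **Assumptions.** (A1) $(rc)^{-1}\sum_{i=1}^r\sum_{j=1}^c\eta_{ij}^2$ stays bounded as $r,c\to\infty$. (A2) $(rc)^{-1/8}(\log(rc))^2\,\nu_{r,c}\,\lambda_1(Q)\to 0$ as $r,c\to\infty$, where $\nu_{r,c}=\max_E K_{ij}/\min_E K_{ij}$ and $\lambda_1(Q)$ is the largest eigenvalue of $Q$. **Corollary.** Under (A1) and (A2), for any hyper-parameter estimates $(\hat\mu,\hat\lambda_A,\hat\lambda_B)$: (a) for every $\varepsilon>0$, $$\lim_{r,c\to\infty}P\big\{L(\eta_c,\hat\eta_c^{\rm URE})\ \ge\ L\big(\eta_c,\tilde ZZ^\dagger\hat\eta^S(\hat\mu,\hat\lambda_A,\hat\lambda_B)\big)+\varepsilon\big\}=0;$$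 (b) both losses are integrable, and $$\limsup_{r,c\to\infty}\Big[\mathbb E\,L(\eta_c,\hat\eta_c^{\rm URE})-\mathbb E\,L\big(\eta_c,\tilde ZZ^\dagger\hat\eta^S(\hat\mu,\hat\lambda_A,\hat\lambda_B)\big)\Big]\le 0.$$ -/

import Mathlib

open MeasureTheory ProbabilityTheory Filter Topology
open scoped ENNReal Matrix

namespace CrossClassified

/-- The four Penrose equations: `X` is a Moore-Penrose inverse of the real matrix `A`. -/
structure IsMoorePenrose {m n : Type*} [Fintype m] [Fintype n]
    (A : Matrix m n ℝ) (X : Matrix n m ℝ) : Prop where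
  left : A * X * A = A
  right : X * A * X = X
  symm_left : (A * X)ᵀ = A * X
  symm_right : (X * A)ᵀ = X * A

theorem exists_isMoorePenrose {m n : Type*} [Fintype m] [Fintype n]
    (A : Matrix m n ℝ) : ∃ X : Matrix n m ℝ, IsMoorePenrose A X := by
  classical
  obtain ⟨T, hT, h1, h2, h3⟩ : ∃ T : Matrix n n ℝ, Tᵀ = T ∧ T * (Aᵀ * A) * T = T ∧
      (Aᵀ * A) * T * (Aᵀ * A) = Aᵀ * A ∧ T * (Aᵀ * A) = (Aᵀ * A) * T := by
    have hS : (Aᵀ * A).IsHermitian := by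
      simpa using Matrix.isHermitian_conjTranspose_mul_self A
    obtain ⟨U, V, d, hVU, hUt, hSd⟩ : ∃ (U V : Matrix n n ℝ) (d : n → ℝ), V * U = 1 ∧
        Uᵀ = V ∧ Aᵀ * A = U * Matrix.diagonal d * V := by
      refine ⟨hS.eigenvectorUnitary, star (hS.eigenvectorUnitary : Matrix n n ℝ),
        hS.eigenvalues, ?_, ?_, ?_⟩
      · exact Unitary.coe_star_mul_self _
      · rw [Matrix.star_eq_conjTranspose, Matrix.conjTranspose_eq_transpose_of_trivial]
      · have := hS.spectral_theorem
        simpa [Unitary.conjStarAlgAut_apply] using this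
    have hV : Vᵀ = U := by rw [← hUt, Matrix.transpose_transpose]
    have key : ∀ a b : n → ℝ, (U * Matrix.diagonal a * V) * (U * Matrix.diagonal b * V)
        = U * Matrix.diagonal (fun i => a i * b i) * V := by
      intro a b
      calc _ = U * Matrix.diagonal a * (V * U) * Matrix.diagonal b * V := by
            simp only [Matrix.mul_assoc]
        _ = _ := by
            rw [hVU, Matrix.mul_one, Matrix.mul_assoc U, Matrix.diagonal_mul_diagonal]
    refine ⟨U * Matrix.diagonal (fun i => (d i)⁻¹) * V, ?_, ?_, ?_, ?_⟩
    · simp only [Matrix.transpose_mul, Matrix.diagonal_transpose, hV, hUt, Matrix.mul_assoc]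
    · rw [hSd, key, key]
      congr 3
      ext i
      by_cases h : d i = 0 <;> simp [h]
    · rw [hSd, key, key]
      congr 3
      ext i
      by_cases h : d i = 0 <;> simp [h]
    · rw [hSd, key, key]
      congr 3
      ext i
      ring
  refine ⟨T * Aᵀ, ?_, ?_, ?_, ?_⟩
  · have h : A * (T * (Aᵀ * A) - 1) = 0 := by
      rw [← Matrix.conjTranspose_mul_self_eq_zero,
        Matrix.conjTranspose_eq_transpose_of_trivial]
      have h4 : Aᵀ * (A * (T * (Aᵀ * A) - 1)) = 0 := by
        rw [← Matrix.mul_assoc, Matrix.mul_sub, Matrix.mul_one, ← Matrix.mul_assoc, h2, sub_self]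
      rw [Matrix.transpose_mul, Matrix.mul_assoc, h4, Matrix.mul_zero]
    rw [Matrix.mul_sub, Matrix.mul_one, sub_eq_zero] at h
    simpa only [Matrix.mul_assoc] using h
  · calc T * Aᵀ * A * (T * Aᵀ) = (T * (Aᵀ * A) * T) * Aᵀ := by simp only [Matrix.mul_assoc]
      _ = T * Aᵀ := by rw [h1]
  · simp only [Matrix.transpose_mul, Matrix.transpose_transpose, hT, Matrix.mul_assoc]
  · calc (T * Aᵀ * A)ᵀ = (Aᵀ * A) * T := by
          simp only [Matrix.transpose_mul, Matrix.transpose_transpose, hT, Matrix.mul_assoc]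
      _ = T * Aᵀ * A := by rw [← h3, Matrix.mul_assoc]

/-- The Moore-Penrose inverse `A†`. -/
noncomputable def pinv {m n : Type*} [Fintype m] [Fintype n] (A : Matrix m n ℝ) :
    Matrix n m ℝ :=
  (exists_isMoorePenrose A).choose

theorem pinv_spec {m n : Type*} [Fintype m] [Fintype n] (A : Matrix m n ℝ) :
    IsMoorePenrose A (pinv A) :=
  (exists_isMoorePenrose A).choose_spec

/-- The largest eigenvalue of a (symmetric) real matrix. -/
noncomputable def maxEigenvalue {n : Type*} [Fintype n] [DecidableEq n]
    (A : Matrix n n ℝ) : ℝ :=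
  sSup (spectrum ℝ A)

/-- The observed cells of an `r × c` table with cell counts `k`: those with positive count. -/
abbrev Obs {r c : ℕ} (k : Fin r → Fin c → ℕ) : Type :=
  {p : Fin r × Fin c // 0 < k p.1 p.2}

/-- The complete design matrix `Z_c = [I_r ⊗ 1_c, 1_r ⊗ I_c]`. -/
def fullDesign (r c : ℕ) : Matrix (Fin r × Fin c) (Fin r ⊕ Fin c) ℝ :=
  Matrix.of fun p s =>
    Sum.elim (fun i => if i = p.1 then 1 else 0) (fun j => if j = p.2 then 1 else 0) s

/-- The vector `η_c = 1 m + Z_c (α, β)` of all cell means. -/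
def cellMeans {r c : ℕ} (m : ℝ) (α : Fin r → ℝ) (β : Fin c → ℝ) : Fin r × Fin c → ℝ :=
  fun p => m + (fullDesign r c *ᵥ Sum.elim α β) p

/-- Normalized sum-of-squares loss over all (observed and missing) cells. -/
noncomputable def loss {r c : ℕ} (η ηhat : Fin r × Fin c → ℝ) : ℝ :=
  ((r : ℝ) * c)⁻¹ * ∑ p, (ηhat p - η p) ^ 2

section Observed

variable {r c : ℕ} (k : Fin r → Fin c → ℕ)

/-- The design matrix `Z` of the observed cells: the corresponding rows of `Z_c`. -/
def design : Matrix (Obs k) (Fin r ⊕ Fin c) ℝ :=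
  (fullDesign r c).submatrix Subtype.val id

/-- All cell means are estimable: they are linear functions of the means of the observed
cells, for all values of the effects. -/
def IsEstimable : Prop :=
  ∃ B : Matrix (Fin r × Fin c) (Obs k) ℝ, B * design k = fullDesign r c

/-- `M = diag (1 / K_ij)` over the observed cells. -/
noncomputable def noiseCov : Matrix (Obs k) (Obs k) ℝ :=
  Matrix.diagonal fun e => ((k e.1.1 e.1.2 : ℕ) : ℝ)⁻¹

/-- Law of the observed data: independent `N(η_ij, σ² / K_ij)`, over the observed cells. -/
noncomputable def dataLaw (σ : ℝ) (η : Fin r × Fin c → ℝ) : Measure (Obs k → ℝ) :=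
  Measure.pi fun e => gaussianReal (η e.1) (Real.toNNReal (σ ^ 2 / k e.1.1 e.1.2))

/-- `Λ = diag (√a I_r, √b I_c)`. -/
noncomputable def effectScale (r c : ℕ) (a b : ℝ) :
    Matrix (Fin r ⊕ Fin c) (Fin r ⊕ Fin c) ℝ :=
  Matrix.diagonal (Sum.elim (fun _ => √a) (fun _ => √b))

/-- `Σ = Z Λ Λᵀ Zᵀ + M`, for finite variance ratios `a`, `b`. -/
noncomputable def margCov (a b : ℝ) : Matrix (Obs k) (Obs k) ℝ :=
  design k * effectScale r c a b * (effectScale r c a b)ᵀ * (design k)ᵀ + noiseCov k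

/-- `Σ⁻¹` as a function of `(λ_A, λ_B) ∈ [0, ∞]²`: extended by continuity from the finite
values, that is, infinite values are understood as limits. -/
noncomputable def precision : ℝ≥0∞ × ℝ≥0∞ → Matrix (Obs k) (Obs k) ℝ :=
  extendFrom {l | l.1 ≠ ∞ ∧ l.2 ≠ ∞} fun l => (margCov k l.1.toReal l.2.toReal)⁻¹

/-- The shrinkage estimate `y - M Σ⁻¹ (y - 1 μ)` of the observed cell means; the
hyper-parameters are `t = (μ, λ_A, λ_B)`. -/
noncomputable def shrinkEst (t : ℝ × ℝ≥0∞ × ℝ≥0∞) (y : Obs k → ℝ) : Obs k → ℝ :=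
  y - (noiseCov k * precision k t.2) *ᵥ (y - fun _ => t.1)

/-- `Z_c Z†`, which extends the observed cell means to all cells. -/
noncomputable def cellMap : Matrix (Fin r × Fin c) (Obs k) ℝ :=
  fullDesign r c * pinv (design k)

/-- The estimate `Z_c Z† η^S(μ, λ_A, λ_B)` of all cell means. -/
noncomputable def cellEst (t : ℝ × ℝ≥0∞ × ℝ≥0∞) (y : Obs k → ℝ) : Fin r × Fin c → ℝ :=
  cellMap k *ᵥ shrinkEst k t y

/-- `Q = (Z_c Z†)ᵀ (Z_c Z†)`. -/
noncomputable def lossMatrix : Matrix (Obs k) (Obs k) ℝ :=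
  (cellMap k)ᵀ * cellMap k

/-- The unbiased risk estimate of `cellEst k t` under `loss`:
`(rc)⁻¹ {σ² tr(QM) - 2σ² tr(Σ⁻¹MQM) + (y - 1μ)ᵀ Σ⁻¹MQMΣ⁻¹ (y - 1μ)}`. -/
noncomputable def ure (σ : ℝ) (t : ℝ × ℝ≥0∞ × ℝ≥0∞) (y : Obs k → ℝ) : ℝ :=
  ((r : ℝ) * c)⁻¹ *
    (σ ^ 2 * (lossMatrix k * noiseCov k).trace
      - 2 * σ ^ 2 * (precision k t.2 * noiseCov k * lossMatrix k * noiseCov k).trace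
      + (y - fun _ => t.1) ⬝ᵥ
        ((precision k t.2 * noiseCov k * lossMatrix k * noiseCov k * precision k t.2) *ᵥ
          (y - fun _ => t.1)))

/-- The `p`-quantile of the observed values: the least `x` such that at least a fraction `p` of
them is at most `x`. -/
noncomputable def quantile (p : ℝ) (y : Obs k → ℝ) : ℝ :=
  sInf {x : ℝ | p * Nat.card (Obs k) ≤ Nat.card {e : Obs k // y e ≤ x}}

/-- The hyper-parameter range `[a_τ, b_τ] × [0, ∞] × [0, ∞]`, where `a_τ` and `b_τ` are the
`τ/2` and `1 - τ/2` quantiles of the observed values. -/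
def hyperRange (τ : ℝ) (y : Obs k → ℝ) : Set (ℝ × ℝ≥0∞ × ℝ≥0∞) :=
  {t | quantile k (τ / 2) y ≤ t.1 ∧ t.1 ≤ quantile k (1 - τ / 2) y}

/-- Hyper-parameter estimates: measurable functions of the data with values in the range. -/
structure IsHyperEst (τ : ℝ) (t : (Obs k → ℝ) → ℝ × ℝ≥0∞ × ℝ≥0∞) : Prop where
  measurable : Measurable t
  mem_range : ∀ y, t y ∈ hyperRange k τ y

/-- URE hyper-parameter estimates: they minimize the URE over the range. -/
structure IsUREHyperEst (σ τ : ℝ) (t : (Obs k → ℝ) → ℝ × ℝ≥0∞ × ℝ≥0∞) : Prop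
    extends IsHyperEst k τ t where
  isMinOn : ∀ y, IsMinOn (fun s => ure k σ s y) (hyperRange k τ y) (t y)

/-- `ν = max K_ij / min K_ij` over the observed cells. -/
noncomputable def countRatio : ℝ :=
  (⨆ e : Obs k, (k e.1.1 e.1.2 : ℝ)) / (⨅ e : Obs k, (k e.1.1 e.1.2 : ℝ))

end Observed

end CrossClassified

/-! The theorem reduces to a uniform approximation (`exists_uniform_ure_bound`): on the whole
hyper-parameter range the risk estimate differs from the loss by at most a random `D` that does not
depend on the hyper-parameters and has mean `O((rc)^(-1/8) (ν λ₁(Q) + 1))`. The minimizer then loses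
at most `2 D` against any competitor pointwise, so (a) is Markov's inequality and (b) is integration
(`integral_le_of_abs_sub_le`).

Whitening by `M^(1/2)` turns `Σ⁻¹` into `R = (1 + a A + b B)⁻¹`, where `A`, `B` are fixed positive
semidefinite matrices of rank at most `r` and `c`. Let `z` be the whitened noise, `u` the whitened
residual and `V = M^(1/2) Q M^(1/2)`. Estimability makes `Z_c Z†` reproduce the true cell means, and
`rc` times the difference of risk estimate and loss is `2 (zᵀ V R u - σ² tr (V R)) - (zᵀ V z - σ² tr
V)` (`ure_sub_loss_eq`).

Uniformity in `R` comes from monotonicity rather than from an entropy bound. In the Loewner order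
`R` is an antitone contraction, and moving `a` from `0` to `∞` changes it by a contraction of rank
at most `rank A`, hence changes `tr (V R)` by at most `‖V‖ rank A`. A grid in `b` alone, equispaced
in `tr (V R(0, b))`, therefore gives `N` brackets of `V`-trace width `tr V / N + ‖V‖ rank A`
(`exists_isBracketing_limitResolvent`). Exchanging the roles of rows and columns if necessary
replaces the rank by at most `min r c ≤ √(rc)`.

At the bracket ends only second moments of quadratic forms are needed, and these are summed over the
grid. Inside a bracket, the Cauchy-Schwarz inequality for the form of the remainder `E = F - R`
separates `u` from `V z`, and the quadratic form of the bracket width in `V z` concentrates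
(`exists_uniform_bound`). The location `μ` is controlled by the quantile constraint: `μ²` is at most
a constant times the mean square of the observations (`card_mul_sq_le_of_mem_hyperRange`). -/

namespace CrossClassified

/-! ### Loewner order: quadratic forms, traces, inverses. -/

section Loewner

variable {n : Type*} [Fintype n]

theorem posSemidef_iff_real {A : Matrix n n ℝ} :
    A.PosSemidef ↔ Aᵀ = A ∧ ∀ x, 0 ≤ x ⬝ᵥ (A *ᵥ x) := by
  rw [Matrix.posSemidef_iff_dotProduct_mulVec, Matrix.IsHermitian,
    Matrix.conjTranspose_eq_transpose_of_trivial]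
  simp

theorem transpose_eq_of_posSemidef {A : Matrix n n ℝ} (hA : A.PosSemidef) : Aᵀ = A :=
  (posSemidef_iff_real.1 hA).1

theorem quadForm_nonneg {A : Matrix n n ℝ} (hA : A.PosSemidef) (x : n → ℝ) :
    0 ≤ x ⬝ᵥ (A *ᵥ x) := (posSemidef_iff_real.1 hA).2 x

theorem quadForm_le {A B : Matrix n n ℝ} (h : (B - A).PosSemidef) (x : n → ℝ) :
    x ⬝ᵥ (A *ᵥ x) ≤ x ⬝ᵥ (B *ᵥ x) := by
  have := quadForm_nonneg h x
  rw [Matrix.sub_mulVec, dotProduct_sub] at this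
  linarith

theorem posSemidef_sub_of_quadForm_le {A B : Matrix n n ℝ} (hA : Aᵀ = A) (hB : Bᵀ = B)
    (h : ∀ x, x ⬝ᵥ (A *ᵥ x) ≤ x ⬝ᵥ (B *ᵥ x)) : (B - A).PosSemidef := by
  refine posSemidef_iff_real.2 ⟨by rw [Matrix.transpose_sub, hA, hB], fun x => ?_⟩
  rw [Matrix.sub_mulVec, dotProduct_sub]
  linarith [h x]

theorem dotProduct_mulVec_comm_of_symm {D : Matrix n n ℝ} (hD : Dᵀ = D) (x u : n → ℝ) :
    u ⬝ᵥ (D *ᵥ x) = x ⬝ᵥ (D *ᵥ u) := by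
  conv_lhs => rw [← hD]
  rw [Matrix.mulVec_transpose, dotProduct_comm, ← Matrix.dotProduct_mulVec]

/-- Expand the nonnegative form at `x ± θ u`. This is Cauchy-Schwarz for a semidefinite form, with a
free weight so that the two sides can be bounded separately. -/
theorem two_mul_abs_dotProduct_mulVec_le {D : Matrix n n ℝ} (hD : D.PosSemidef) {θ : ℝ}
    (hθ : 0 < θ) (x u : n → ℝ) :
    2 * |x ⬝ᵥ (D *ᵥ u)| ≤ θ * (u ⬝ᵥ (D *ᵥ u)) + x ⬝ᵥ (D *ᵥ x) / θ := by
  have hc := dotProduct_mulVec_comm_of_symm (transpose_eq_of_posSemidef hD) x u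
  have key : ∀ s : ℝ, 0 ≤ x ⬝ᵥ (D *ᵥ x) + 2 * s * (x ⬝ᵥ (D *ᵥ u)) + s ^ 2 * (u ⬝ᵥ (D *ᵥ u)) := by
    intro s
    have := quadForm_nonneg hD (x + s • u)
    rw [Matrix.mulVec_add, Matrix.mulVec_smul, dotProduct_add, add_dotProduct, add_dotProduct,
      dotProduct_smul, dotProduct_smul, smul_dotProduct, smul_dotProduct, hc] at this
    simp only [smul_eq_mul] at this
    linarith
  have h1 := key θ
  have h2 := key (-θ)
  have : 2 * |x ⬝ᵥ (D *ᵥ u)| * θ ≤ (θ * (u ⬝ᵥ (D *ᵥ u)) + x ⬝ᵥ (D *ᵥ x) / θ) * θ := by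
    rw [add_mul, div_mul_cancel₀ _ hθ.ne']
    rcases abs_cases (x ⬝ᵥ (D *ᵥ u)) with ⟨h, _⟩ | ⟨h, _⟩ <;> rw [h] <;> nlinarith
  exact le_of_mul_le_mul_right this hθ

theorem posSemidef_conj {A : Matrix n n ℝ} (hA : A.PosSemidef) {B : Matrix n n ℝ} (hB : Bᵀ = B) :
    (B * A * B).PosSemidef := by
  have := hA.mul_mul_conjTranspose_same B
  rwa [Matrix.conjTranspose_eq_transpose_of_trivial, hB] at this

variable [DecidableEq n]

theorem posSemidef_mul_self {B : Matrix n n ℝ} (hB : Bᵀ = B) : (B * B).PosSemidef := by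
  simpa using posSemidef_conj Matrix.PosSemidef.one hB

/-- Writing `D = Yᴴ Y` and cycling turns the trace into that of `Y C Yᴴ`, although `C * D` itself
need not be symmetric. -/
theorem trace_mul_nonneg {C D : Matrix n n ℝ} (hC : C.PosSemidef) (hD : D.PosSemidef) :
    0 ≤ (C * D).trace := by
  obtain ⟨Y, rfl⟩ : ∃ Y : Matrix n n ℝ, D = Yᴴ * Y := by
    open scoped MatrixOrder in
    exact CStarAlgebra.nonneg_iff_eq_star_mul_self.1 hD.nonneg
  have := (hC.mul_mul_conjTranspose_same Y).trace_nonneg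
  rw [← Matrix.mul_assoc, Matrix.trace_mul_comm, ← Matrix.mul_assoc]
  exact this

theorem trace_mul_le {C D D' : Matrix n n ℝ} (hC : C.PosSemidef) (hD : (D' - D).PosSemidef) :
    (C * D).trace ≤ (C * D').trace := by
  have := trace_mul_nonneg hC hD
  rw [Matrix.mul_sub, Matrix.trace_sub] at this
  linarith

theorem trace_le {D D' : Matrix n n ℝ} (hD : (D' - D).PosSemidef) : D.trace ≤ D'.trace := by
  simpa using trace_mul_le Matrix.PosSemidef.one hD

theorem trace_mul_le_smul {C D : Matrix n n ℝ} {c : ℝ} (hC : (c • (1 : Matrix n n ℝ) - C).PosSemidef)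
    (hD : D.PosSemidef) : (C * D).trace ≤ c * D.trace := by
  have := trace_mul_nonneg hC hD
  rw [Matrix.sub_mul, Matrix.trace_sub, Matrix.smul_mul, Matrix.one_mul, Matrix.trace_smul,
    smul_eq_mul] at this
  linarith

/-- For `c > 0` this rests on `c (c A - A²) = A (c - A) A + (c - A) A (c - A)`, which avoids any
spectral calculus. For `c = 0` the trace forces `A = 0`. -/
theorem smul_self_sub_sq_posSemidef {A : Matrix n n ℝ} {c : ℝ} (hc : 0 ≤ c) (hA : A.PosSemidef)
    (hAc : (c • (1 : Matrix n n ℝ) - A).PosSemidef) : (c • A - A * A).PosSemidef := by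
  rcases hc.eq_or_lt with rfl | hc
  · have h : A.trace ≤ 0 := by
      have := hAc.trace_nonneg
      simp at this; linarith
    have : A = 0 := hA.trace_eq_zero_iff.1 (le_antisymm h hA.trace_nonneg)
    simp [this, Matrix.PosSemidef.zero]
  · have hAt := transpose_eq_of_posSemidef hA
    have h1 := posSemidef_conj hAc hAt
    have h2 := posSemidef_conj hA (transpose_eq_of_posSemidef hAc)
    have h3 := (h1.add h2).smul (inv_nonneg.2 hc.le)
    convert h3 using 1
    have : A * (c • 1 - A) * A + (c • 1 - A) * A * (c • 1 - A) = c • (c • A - A * A) := by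
      simp only [Matrix.mul_sub, Matrix.sub_mul, Matrix.mul_smul, Matrix.smul_mul, Matrix.mul_one,
        Matrix.one_mul, smul_sub]
      abel
    rw [this, smul_smul, inv_mul_cancel₀ hc.ne', one_smul]

theorem quadForm_smul_one (x : n → ℝ) (c : ℝ) :
    x ⬝ᵥ ((c • (1 : Matrix n n ℝ)) *ᵥ x) = c * (x ⬝ᵥ x) := by
  rw [Matrix.smul_mulVec, Matrix.one_mulVec, dotProduct_smul, smul_eq_mul]

/-- Using the resolvent identity twice writes the difference as `T⁻¹ (T - S) T⁻¹ + T⁻¹ (T - S) S⁻¹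
(T - S) T⁻¹`, a sum of two congruences of positive semidefinite matrices. -/
theorem inv_sub_inv_posSemidef {S T : Matrix n n ℝ} (hS : S.PosDef) (hT : T.PosDef)
    (h : (T - S).PosSemidef) : (S⁻¹ - T⁻¹).PosSemidef := by
  have hSu := (Matrix.isUnit_iff_isUnit_det _).1 hS.isUnit
  have hTu := (Matrix.isUnit_iff_isUnit_det _).1 hT.isUnit
  have hTt := transpose_eq_of_posSemidef hT.inv.posSemidef
  have hDt := transpose_eq_of_posSemidef h
  have e1 : S⁻¹ - T⁻¹ = T⁻¹ * (T - S) * S⁻¹ := by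
    rw [Matrix.mul_sub, Matrix.sub_mul, Matrix.nonsing_inv_mul _ hTu, Matrix.one_mul,
      Matrix.mul_assoc, Matrix.mul_nonsing_inv _ hSu, Matrix.mul_one]
  have e2 : S⁻¹ - T⁻¹ = S⁻¹ * (T - S) * T⁻¹ := by
    rw [Matrix.mul_sub, Matrix.sub_mul, Matrix.nonsing_inv_mul _ hSu, Matrix.one_mul,
      Matrix.mul_assoc, Matrix.mul_nonsing_inv _ hTu, Matrix.mul_one]
  have e3 : S⁻¹ - T⁻¹ = T⁻¹ * (T - S) * T⁻¹ + T⁻¹ * ((T - S) * S⁻¹ * (T - S)) * T⁻¹ := by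
    have e4 : S⁻¹ = T⁻¹ + S⁻¹ * (T - S) * T⁻¹ := by rw [← e2]; abel
    calc S⁻¹ - T⁻¹ = T⁻¹ * (T - S) * S⁻¹ := e1
      _ = T⁻¹ * (T - S) * (T⁻¹ + S⁻¹ * (T - S) * T⁻¹) := by rw [← e4]
      _ = _ := by rw [Matrix.mul_add]; simp only [Matrix.mul_assoc]
  rw [e3]
  exact (posSemidef_conj h hTt).add (posSemidef_conj (posSemidef_conj hS.inv.posSemidef hDt) hTt)

/-- A positive semidefinite contraction has trace at most its rank. -/
theorem trace_le_rank {D : Matrix n n ℝ} (hD : D.PosSemidef)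
    (hD1 : ((1 : Matrix n n ℝ) - D).PosSemidef) : D.trace ≤ D.rank := by
  have hH := hD.isHermitian
  -- Rayleigh quotient at a unit eigenvector. The trace then sums numbers at most `1`, of which
  -- exactly the rank are nonzero.
  have hle : ∀ i, hH.eigenvalues i ≤ 1 := by
    intro i
    rw [hH.eigenvalues_eq]
    set v : n → ℝ := ⇑(hH.eigenvectorBasis i) with hv
    have h1 : v ⬝ᵥ v = 1 := by
      have h2 : inner ℝ (hH.eigenvectorBasis i) (hH.eigenvectorBasis i) = (1 : ℝ) := by
        rw [real_inner_self_eq_norm_sq, hH.eigenvectorBasis.orthonormal.1 i]; norm_num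
      rw [EuclideanSpace.inner_eq_star_dotProduct] at h2
      simpa using h2
    have := quadForm_le hD1 v
    rw [Matrix.one_mulVec, h1] at this
    simpa using this
  rw [hH.trace_eq_sum_eigenvalues, hH.rank_eq_card_non_zero_eigs, Fintype.card_subtype,
    Finset.card_eq_sum_ones, Finset.sum_filter]
  push_cast
  refine Finset.sum_le_sum fun i _ => ?_
  split_ifs with h
  · simpa using hle i
  · simp only [ne_eq, not_not] at h; simp [h]

end Loewner

end CrossClassified

namespace CrossClassified

/-! ### The resolvent of two semidefinite matrices and its limits at infinite coefficients. -/

section Resolvent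

/-- The pairs of finite variance ratios. -/
def finitePairs : Set (ℝ≥0∞ × ℝ≥0∞) := {l | l.1 ≠ ∞ ∧ l.2 ≠ ∞}

theorem tendsto_min_natCast (a : ℝ≥0∞) :
    Tendsto (fun N : ℕ => min a (N : ℝ≥0∞)) atTop (𝓝 a) := by
  have : Tendsto (fun N : ℕ => min a (N : ℝ≥0∞)) atTop (𝓝 (min a ∞)) :=
    tendsto_const_nhds.min ENNReal.tendsto_nat_nhds_top
  simpa using this

theorem min_natCast_ne_top (a : ℝ≥0∞) (N : ℕ) : min a (N : ℝ≥0∞) ≠ ∞ :=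
  ne_top_of_le_ne_top (ENNReal.natCast_ne_top N) (min_le_right _ _)

/-- Truncation preserves the order of pairs, so Loewner inequalities between finite resolvents pass
to the extension along this sequence. -/
theorem tendsto_min_natCast_finitePairs (l : ℝ≥0∞ × ℝ≥0∞) :
    Tendsto (fun N : ℕ => (min l.1 (N : ℝ≥0∞), min l.2 (N : ℝ≥0∞))) atTop (𝓝[finitePairs] l) := by
  refine tendsto_nhdsWithin_iff.2 ⟨?_, Eventually.of_forall fun N => ?_⟩
  · exact (tendsto_min_natCast l.1).prodMk_nhds (tendsto_min_natCast l.2)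
  · exact ⟨min_natCast_ne_top _ _, min_natCast_ne_top _ _⟩

theorem dense_finitePairs : Dense finitePairs := fun l =>
  mem_closure_iff_nhdsWithin_neBot.2 (tendsto_min_natCast_finitePairs l).neBot

/-- A nonnegative function of two finite variance ratios that is antitone up to a Lipschitz error
has limits at all points of `[0, ∞]²`. -/
theorem exists_tendsto_of_antitone_lipschitz {f : ℝ≥0∞ × ℝ≥0∞ → ℝ} {L : ℝ} (hL : 0 ≤ L)
    (hf : ∀ l ∈ finitePairs, 0 ≤ f l)
    (h : ∀ l ∈ finitePairs, ∀ l' ∈ finitePairs, ∀ δ : ℝ, 0 ≤ δ →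
      l.1 ≤ l'.1 + ENNReal.ofReal δ → l.2 ≤ l'.2 + ENNReal.ofReal δ → f l' ≤ f l + L * δ)
    (l₀ : ℝ≥0∞ × ℝ≥0∞) : ∃ y, Tendsto f (𝓝[finitePairs] l₀) (𝓝 y) := by
  -- The limit is the infimum of `f` over the finite pairs below `l₀`; an almost optimal `l'` bounds
  -- `f` from above near `l₀`.
  set s : Set ℝ := f '' {l | l ∈ finitePairs ∧ l ≤ l₀} with hs
  have hne : s.Nonempty := ⟨f 0, 0, ⟨⟨by simp, by simp⟩, by simp⟩, rfl⟩
  have hbdd : BddBelow s := ⟨0, by rintro _ ⟨l, hl, rfl⟩; exact hf l hl.1⟩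
  refine ⟨sInf s, Metric.tendsto_nhds.2 fun ε hε => ?_⟩
  obtain ⟨_, ⟨l', ⟨hl', hl'0⟩, rfl⟩, hlt⟩ :=
    exists_lt_of_csInf_lt hne (show sInf s < sInf s + ε / 2 by linarith)
  obtain ⟨δ, hδ, hLδ⟩ : ∃ δ : ℝ, 0 < δ ∧ L * δ < ε / 2 := by
    refine ⟨ε / (2 * (L + 1)), by positivity, ?_⟩
    rw [mul_div_assoc', div_lt_div_iff₀ (by positivity) (by positivity)]
    nlinarith
  have hδ' : (0 : ℝ≥0∞) < ENNReal.ofReal δ := ENNReal.ofReal_pos.2 hδ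
  have near : ∀ a a' : ℝ≥0∞, a' ≠ ∞ → a' ≤ a →
      ∀ᶠ x in 𝓝 a, a' ≤ x + ENNReal.ofReal δ ∧ x ≤ a + ENNReal.ofReal δ := by
    intro a a' ha' haa
    refine Eventually.and ?_ ?_
    · have h1 : a' < a + ENNReal.ofReal δ :=
        (ENNReal.lt_add_right ha' hδ'.ne').trans_le (add_le_add_left haa _)
      have h2 : Tendsto (fun x => x + ENNReal.ofReal δ) (𝓝 a) (𝓝 (a + ENNReal.ofReal δ)) :=
        (tendsto_id.add tendsto_const_nhds)
      exact (h2.eventually (lt_mem_nhds h1)).mono fun x hx => hx.le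
    · rcases eq_or_ne a ∞ with rfl | ha
      · simp
      · exact (gt_mem_nhds (ENNReal.lt_add_right ha hδ'.ne')).mono fun x hx => hx.le
  have hev : ∀ᶠ l in 𝓝 l₀, (l'.1 ≤ l.1 + ENNReal.ofReal δ ∧ l.1 ≤ l₀.1 + ENNReal.ofReal δ) ∧
      (l'.2 ≤ l.2 + ENNReal.ofReal δ ∧ l.2 ≤ l₀.2 + ENNReal.ofReal δ) :=
    (continuous_fst.continuousAt.eventually (near l₀.1 l'.1 hl'.1 hl'0.1)).and
      (continuous_snd.continuousAt.eventually (near l₀.2 l'.2 hl'.2 hl'0.2))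
  filter_upwards [mem_nhdsWithin_of_mem_nhds hev, self_mem_nhdsWithin] with l hl hlD
  obtain ⟨⟨h1, h2⟩, h3, h4⟩ := hl
  have hup := h l' hl' l hlD δ hδ.le h1 h3
  -- A nearby `l` need not lie below `l₀`, but it exceeds it by at most `δ` in each coordinate, so
  -- passing to `l ⊓ l₀` costs only `L * δ`.
  have hmin : l ⊓ l₀ ∈ finitePairs :=
    ⟨ne_top_of_le_ne_top hlD.1 inf_le_left, ne_top_of_le_ne_top hlD.2 inf_le_left⟩
  have hlow : f (l ⊓ l₀) ≤ f l + L * δ := by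
    refine h l hlD _ hmin δ hδ.le ?_ ?_
    · change l.1 ≤ min l.1 l₀.1 + ENNReal.ofReal δ
      rw [min_add]; exact le_min le_self_add h2
    · change l.2 ≤ min l.2 l₀.2 + ENNReal.ofReal δ
      rw [min_add]; exact le_min le_self_add h4
  have hm : sInf s ≤ f (l ⊓ l₀) := csInf_le hbdd ⟨_, ⟨hmin, inf_le_right⟩, rfl⟩
  rw [Real.dist_eq, abs_lt]
  constructor <;> linarith

variable {n : Type*} [Fintype n] [DecidableEq n]

/-- The constant is crude on purpose: it serves only to prove that limits exist and enters no rate.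
-/
theorem exists_smul_one_sub_posSemidef {A : Matrix n n ℝ} (hA : Aᵀ = A) :
    ∃ c : ℝ, 0 ≤ c ∧ (c • (1 : Matrix n n ℝ) - A).PosSemidef := by
  refine ⟨∑ i, ∑ j, |A i j|, by positivity, posSemidef_sub_of_quadForm_le hA (by simp) fun x => ?_⟩
  have hx : ∀ i, x i ^ 2 ≤ x ⬝ᵥ x := fun i => by
    rw [pow_two]
    exact Finset.single_le_sum (f := fun i => x i * x i) (fun i _ => mul_self_nonneg _)
      (Finset.mem_univ i)
  rw [quadForm_smul_one, Finset.sum_mul, dotProduct]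
  refine Finset.sum_le_sum fun i _ => ?_
  rw [Matrix.mulVec, dotProduct, Finset.mul_sum, Finset.sum_mul]
  refine Finset.sum_le_sum fun j _ => ?_
  calc x i * (A i j * x j) ≤ |A i j| * (|x i| * |x j|) := by
        refine (le_abs_self _).trans (le_of_eq ?_)
        rw [abs_mul, abs_mul]; ring
    _ ≤ |A i j| * (x ⬝ᵥ x) := by
        refine mul_le_mul_of_nonneg_left ?_ (abs_nonneg _)
        have h1 := hx i
        have h2 := hx j
        rw [← sq_abs] at h1 h2
        nlinarith [sq_nonneg (|x i| - |x j|)]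

/-- `(1 + a A + b B)⁻¹`. -/
noncomputable def resolvent (A B : Matrix n n ℝ) (a b : ℝ) : Matrix n n ℝ :=
  (1 + a • A + b • B)⁻¹

variable {A B : Matrix n n ℝ} (hA : A.PosSemidef) (hB : B.PosSemidef)

include hA hB

theorem posDef_one_add_smul {a b : ℝ} (ha : 0 ≤ a) (hb : 0 ≤ b) :
    (1 + a • A + b • B).PosDef :=
  (Matrix.PosDef.one.add_posSemidef (hA.smul ha)).add_posSemidef (hB.smul hb)

theorem resolvent_posSemidef {a b : ℝ} (ha : 0 ≤ a) (hb : 0 ≤ b) :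
    (resolvent A B a b).PosSemidef :=
  (posDef_one_add_smul hA hB ha hb).inv.posSemidef

theorem resolvent_antitone {a b a' b' : ℝ} (ha : 0 ≤ a) (hb : 0 ≤ b) (haa : a ≤ a')
    (hbb : b ≤ b') : (resolvent A B a b - resolvent A B a' b').PosSemidef := by
  refine inv_sub_inv_posSemidef (posDef_one_add_smul hA hB ha hb)
    (posDef_one_add_smul hA hB (ha.trans haa) (hb.trans hbb)) ?_
  have := (hA.smul (sub_nonneg.2 haa)).add (hB.smul (sub_nonneg.2 hbb))
  convert this using 1
  rw [sub_smul, sub_smul]; abel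

theorem one_sub_resolvent_posSemidef {a b : ℝ} (ha : 0 ≤ a) (hb : 0 ≤ b) :
    (1 - resolvent A B a b).PosSemidef := by
  simpa [resolvent] using resolvent_antitone hA hB le_rfl le_rfl ha hb

/-- If `A + B ≤ c`, then adding `δ` to both coefficients enlarges `1 + a' A + b' B` by a factor of
at most `1 + δ c`, so the inverse shrinks by no more than that factor. As the inverse is at most
`1`, the loss is at most `δ c (x ⬝ᵥ x)`. Antitonicity does the rest. -/
theorem exists_lipschitz_resolvent (x : n → ℝ) : ∃ L : ℝ, 0 ≤ L ∧ ∀ a b a' b' δ : ℝ, 0 ≤ a → 0 ≤ b →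
    0 ≤ a' → 0 ≤ b' → 0 ≤ δ → a ≤ a' + δ → b ≤ b' + δ →
    x ⬝ᵥ (resolvent A B a' b' *ᵥ x) ≤ x ⬝ᵥ (resolvent A B a b *ᵥ x) + L * δ := by
  obtain ⟨c, hc, hcAB⟩ := exists_smul_one_sub_posSemidef
    (transpose_eq_of_posSemidef (hA.add hB))
  have hxx : 0 ≤ x ⬝ᵥ x := by simpa using quadForm_nonneg Matrix.PosSemidef.one x
  refine ⟨c * (x ⬝ᵥ x), by positivity, fun a b a' b' δ ha hb ha' hb' hδ haa hbb => ?_⟩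
  have h1 := quadForm_le (resolvent_antitone hA hB ha hb haa hbb) x
  have hS := posDef_one_add_smul hA hB ha' hb'
  have hT := posDef_one_add_smul hA hB (add_nonneg ha' hδ) (add_nonneg hb' hδ)
  have hp : 0 < 1 + δ * c := by positivity
  have h2 : ((1 + δ * c) • (1 + a' • A + b' • B) -
      (1 + (a' + δ) • A + (b' + δ) • B)).PosSemidef := by
    have := (hcAB.smul hδ).add (((hA.smul ha').add (hB.smul hb')).smul (mul_nonneg hδ hc))
    convert this using 1
    module
  have h3 := quadForm_le (inv_sub_inv_posSemidef hT (hS.smul hp) h2) x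
  have hinv : ((1 + δ * c) • (1 + a' • A + b' • B))⁻¹ = (1 + δ * c)⁻¹ • resolvent A B a' b' := by
    refine Matrix.inv_eq_left_inv ?_
    rw [resolvent, Matrix.smul_mul, Matrix.mul_smul, smul_smul, inv_mul_cancel₀ hp.ne', one_smul,
      Matrix.nonsing_inv_mul _ ((Matrix.isUnit_iff_isUnit_det _).1 hS.isUnit)]
  rw [hinv, Matrix.smul_mulVec, dotProduct_smul, smul_eq_mul, inv_mul_le_iff₀ hp] at h3
  have h4 := quadForm_le (one_sub_resolvent_posSemidef hA hB (add_nonneg ha' hδ)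
    (add_nonneg hb' hδ)) x
  rw [Matrix.one_mulVec] at h4
  change _ ≤ (1 + δ * c) * (x ⬝ᵥ (resolvent A B (a' + δ) (b' + δ) *ᵥ x)) at h3
  nlinarith [mul_le_mul_of_nonneg_left h4 (mul_nonneg hδ hc)]

/-- Every quadratic form of the resolvent converges, by antitonicity up to a Lipschitz error;
polarization recovers the entries. -/
theorem exists_tendsto_resolvent (l₀ : ℝ≥0∞ × ℝ≥0∞) : ∃ Y,
    Tendsto (fun l : ℝ≥0∞ × ℝ≥0∞ => resolvent A B l.1.toReal l.2.toReal)
      (𝓝[finitePairs] l₀) (𝓝 Y) := by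
  have hq : ∀ x : n → ℝ, ∃ y, Tendsto (fun l : ℝ≥0∞ × ℝ≥0∞ =>
      x ⬝ᵥ (resolvent A B l.1.toReal l.2.toReal *ᵥ x)) (𝓝[finitePairs] l₀) (𝓝 y) := by
    intro x
    obtain ⟨L, hL, h⟩ := exists_lipschitz_resolvent hA hB x
    refine exists_tendsto_of_antitone_lipschitz hL (fun l _ => quadForm_nonneg
      (resolvent_posSemidef hA hB ENNReal.toReal_nonneg ENNReal.toReal_nonneg) x)
      (fun l hl l' hl' δ hδ h1 h2 => h _ _ _ _ δ ENNReal.toReal_nonneg ENNReal.toReal_nonneg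
        ENNReal.toReal_nonneg ENNReal.toReal_nonneg hδ ?_ ?_) l₀
    · have := ENNReal.toReal_mono (by simp [hl'.1]) h1
      rwa [ENNReal.toReal_add hl'.1 (by simp), ENNReal.toReal_ofReal hδ] at this
    · have := ENNReal.toReal_mono (by simp [hl'.2]) h2
      rwa [ENNReal.toReal_add hl'.2 (by simp), ENNReal.toReal_ofReal hδ] at this
  choose y hy using hq
  refine ⟨Matrix.of fun i j => (y (Pi.single i 1 + Pi.single j 1) -
    y (Pi.single i 1 - Pi.single j 1)) / 4, ?_⟩
  refine tendsto_pi_nhds.2 fun i => tendsto_pi_nhds.2 fun j => ?_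
  have := ((hy (Pi.single i 1 + Pi.single j 1)).sub (hy (Pi.single i 1 - Pi.single j 1))).div_const 4
  refine this.congr fun l => ?_
  have hsymm := transpose_eq_of_posSemidef (resolvent_posSemidef hA hB
    (ENNReal.toReal_nonneg (a := l.1)) (ENNReal.toReal_nonneg (a := l.2)))
  set R := resolvent A B l.1.toReal l.2.toReal
  have hji : R j i = R i j := by rw [← hsymm, Matrix.transpose_apply, hsymm]
  simp only [Matrix.mulVec_add, Matrix.mulVec_sub, dotProduct_add, add_dotProduct, dotProduct_sub,
    sub_dotProduct, Matrix.mulVec_single_one, single_one_dotProduct, Matrix.col_apply, hji]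
  ring

end Resolvent

end CrossClassified

namespace CrossClassified

/-! ### Order properties of the extended resolvent. -/

section LimitResolvent

theorem posSemidef_of_tendsto {n : Type*} [Fintype n] {ι : Type*} {f : Filter ι} [f.NeBot]
    {F : ι → Matrix n n ℝ} {Y : Matrix n n ℝ} (hF : Tendsto F f (𝓝 Y))
    (h : ∀ i, (F i).PosSemidef) : Y.PosSemidef := by
  refine posSemidef_iff_real.2 ⟨?_, fun x => ?_⟩
  · have h1 : Tendsto (fun i => (F i)ᵀ) f (𝓝 Yᵀ) :=
      ((continuous_id.matrix_transpose).tendsto Y).comp hF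
    refine tendsto_nhds_unique (h1.congr fun i => transpose_eq_of_posSemidef (h i)) hF
  · have h1 : Tendsto (fun i => x ⬝ᵥ (F i *ᵥ x)) f (𝓝 (x ⬝ᵥ (Y *ᵥ x))) := by
      have : Continuous fun M : Matrix n n ℝ => x ⬝ᵥ (M *ᵥ x) :=
        continuous_const.dotProduct (continuous_id.matrix_mulVec continuous_const)
      exact (this.tendsto Y).comp hF
    exact ge_of_tendsto' h1 fun i => quadForm_nonneg (h i) x

variable {n : Type*} [Fintype n] [DecidableEq n]

/-- The continuous extension of `(a, b) ↦ (1 + a A + b B)⁻¹` to `[0, ∞]²`. -/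
noncomputable def limitResolvent (A B : Matrix n n ℝ) : ℝ≥0∞ × ℝ≥0∞ → Matrix n n ℝ :=
  extendFrom finitePairs fun l => resolvent A B l.1.toReal l.2.toReal

variable {A B : Matrix n n ℝ} (hA : A.PosSemidef) (hB : B.PosSemidef)

include hA hB

theorem tendsto_limitResolvent (l : ℝ≥0∞ × ℝ≥0∞) :
    Tendsto (fun l : ℝ≥0∞ × ℝ≥0∞ => resolvent A B l.1.toReal l.2.toReal)
      (𝓝[finitePairs] l) (𝓝 (limitResolvent A B l)) :=
  tendsto_extendFrom (exists_tendsto_resolvent hA hB l)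

theorem tendsto_resolvent_min (l : ℝ≥0∞ × ℝ≥0∞) :
    Tendsto (fun N : ℕ => resolvent A B (min l.1 N).toReal (min l.2 N).toReal) atTop
      (𝓝 (limitResolvent A B l)) := by
  have h := (tendsto_limitResolvent hA hB l).comp (tendsto_min_natCast_finitePairs l)
  simpa only [Function.comp_def] using h

theorem continuous_limitResolvent : Continuous (limitResolvent A B) :=
  continuous_extendFrom dense_finitePairs (exists_tendsto_resolvent hA hB)

theorem limitResolvent_posSemidef (l : ℝ≥0∞ × ℝ≥0∞) : (limitResolvent A B l).PosSemidef :=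
  posSemidef_of_tendsto (tendsto_resolvent_min hA hB l) fun _ =>
    resolvent_posSemidef hA hB ENNReal.toReal_nonneg ENNReal.toReal_nonneg

theorem one_sub_limitResolvent_posSemidef (l : ℝ≥0∞ × ℝ≥0∞) :
    (1 - limitResolvent A B l).PosSemidef :=
  posSemidef_of_tendsto (tendsto_const_nhds.sub (tendsto_resolvent_min hA hB l)) fun _ =>
    one_sub_resolvent_posSemidef hA hB ENNReal.toReal_nonneg ENNReal.toReal_nonneg

theorem limitResolvent_antitone {l l' : ℝ≥0∞ × ℝ≥0∞} (h : l ≤ l') :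
    (limitResolvent A B l - limitResolvent A B l').PosSemidef :=
  posSemidef_of_tendsto ((tendsto_resolvent_min hA hB l).sub (tendsto_resolvent_min hA hB l'))
    fun _ => resolvent_antitone hA hB ENNReal.toReal_nonneg ENNReal.toReal_nonneg
      (ENNReal.toReal_mono (min_natCast_ne_top _ _) (min_le_min_right _ h.1))
      (ENNReal.toReal_mono (min_natCast_ne_top _ _) (min_le_min_right _ h.2))

theorem limitResolvent_swap (a b : ℝ≥0∞) : limitResolvent B A (b, a) = limitResolvent A B (a, b) := by
  refine tendsto_nhds_unique (tendsto_resolvent_min hB hA (b, a)) ?_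
  refine (tendsto_resolvent_min hA hB (a, b)).congr fun N => ?_
  rw [resolvent, resolvent, add_right_comm]

/-- Letting the coefficient of `A` go from `0` to `∞` changes the trace by at most `rank A`. -/
theorem trace_limitResolvent_sub_le_rank (b : ℝ≥0∞) :
    (limitResolvent A B (0, b) - limitResolvent A B (∞, b)).trace ≤ A.rank := by
  have hcont : Continuous fun M : Matrix n n ℝ => M.trace := continuous_id.matrix_trace
  refine le_of_tendsto' ((hcont.tendsto _).comp ((tendsto_resolvent_min hA hB (0, b)).sub
    (tendsto_resolvent_min hA hB (∞, b)))) fun N => ?_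
  set β := (min b (N : ℝ≥0∞)).toReal
  have hβ : 0 ≤ β := ENNReal.toReal_nonneg
  have hN : (0 : ℝ) ≤ N := Nat.cast_nonneg N
  have hz : resolvent A B (min 0 (N : ℝ≥0∞)).toReal β = resolvent A B 0 β := by simp
  have hi : resolvent A B (min ∞ (N : ℝ≥0∞)).toReal β = resolvent A B N β := by simp
  change (resolvent A B (min 0 (N : ℝ≥0∞)).toReal β -
    resolvent A B (min ∞ (N : ℝ≥0∞)).toReal β).trace ≤ _
  rw [hz, hi]
  have h0 := resolvent_antitone hA hB le_rfl hβ hN le_rfl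
  have h1 : (1 - (resolvent A B 0 β - resolvent A B N β)).PosSemidef := by
    convert (one_sub_resolvent_posSemidef hA hB le_rfl hβ).add
      (resolvent_posSemidef hA hB hN hβ) using 1
    abel
  refine (trace_le_rank h0 h1).trans ?_
  have hS := (Matrix.isUnit_iff_isUnit_det _).1 (posDef_one_add_smul hA hB le_rfl hβ).isUnit
  have hT := (Matrix.isUnit_iff_isUnit_det _).1 (posDef_one_add_smul hA hB hN hβ).isUnit
  -- By the resolvent identity the difference contains `A` as a factor, so its rank is at most `rank
  -- A` whatever `N` is, and the bound survives the limit.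
  have : resolvent A B 0 β - resolvent A B N β =
      resolvent A B 0 β * ((N : ℝ) • A) * resolvent A B N β := by
    have e : (N : ℝ) • A = (1 + (N : ℝ) • A + β • B) - (1 + (0 : ℝ) • A + β • B) := by module
    rw [e, resolvent, resolvent, Matrix.mul_sub, Matrix.sub_mul, Matrix.nonsing_inv_mul _ hS,
      Matrix.one_mul, Matrix.mul_assoc, Matrix.mul_nonsing_inv _ hT, Matrix.mul_one]
  rw [this]
  have : resolvent A B 0 β * ((N : ℝ) • A) * resolvent A B N β =
      ((N : ℝ) • resolvent A B 0 β) * A * resolvent A B N β := by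
    rw [Matrix.mul_smul, Matrix.smul_mul, Matrix.smul_mul, Matrix.smul_mul]
  rw [this]
  exact_mod_cast (Matrix.rank_mul_le_left _ _).trans (Matrix.rank_mul_le_right _ _)

end LimitResolvent

/-! ### Bracketing the family of resolvents by a one-dimensional grid. -/

section Bracketing

/-- Upper brackets `F j` and bracket widths `D j`, `j < N`, for a set `S` of positive semidefinite
contractions, such that all widths satisfy `tr (C D) ≤ w`. -/
structure IsBracketing {n : Type*} [Fintype n] [DecidableEq n] {N : ℕ} (S : Set (Matrix n n ℝ))
    (C : Matrix n n ℝ) (w : ℝ) (F D : Fin N → Matrix n n ℝ) : Prop where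
  posSemidef_upper : ∀ j, (F j).PosSemidef
  one_sub_upper : ∀ j, (1 - F j).PosSemidef
  posSemidef_width : ∀ j, (D j).PosSemidef
  one_sub_width : ∀ j, (1 - D j).PosSemidef
  trace_width : ∀ j, (C * D j).trace ≤ w
  exists_mem : ∀ R ∈ S, ∃ j, (F j - R).PosSemidef ∧ (D j - (F j - R)).PosSemidef

theorem exists_lt_bracket {α : Type*} [LinearOrder α] (b : ℕ → α) (x : α) (N : ℕ) (hN : 0 < N)
    (h0 : b 0 ≤ x) (h1 : x ≤ b N) : ∃ j < N, b j ≤ x ∧ x ≤ b (j + 1) := by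
  induction N with
  | zero => omega
  | succ N ih =>
    rcases Nat.eq_zero_or_pos N with rfl | hN
    · exact ⟨0, by omega, h0, h1⟩
    · rcases le_total x (b N) with h | h
      · obtain ⟨j, hj, hj'⟩ := ih hN h
        exact ⟨j, by omega, hj'⟩
      · exact ⟨N, by omega, h, h1⟩

variable {n : Type*} [Fintype n] [DecidableEq n] {A B : Matrix n n ℝ}

/-- For `b_j ≤ b ≤ b_{j+1}`, antitonicity places `Φ(a, b)` between `Φ(∞, b_{j+1})` and `Φ(0, b_j)`
for every `a`. The width splits into one grid step of `tr (C Φ(0, ·))` and one drop in `a` from `0`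
to `∞`, which the rank controls. -/
theorem exists_isBracketing_limitResolvent (hA : A.PosSemidef) (hB : B.PosSemidef)
    {C : Matrix n n ℝ} (hC : C.PosSemidef) {c : ℝ} (hc : 0 ≤ c)
    (hCc : (c • (1 : Matrix n n ℝ) - C).PosSemidef) {N : ℕ} (hN : 0 < N) :
    ∃ F D : Fin N → Matrix n n ℝ, IsBracketing (Set.range (limitResolvent A B)) C
      (C.trace / N + c * A.rank) F D := by
  set Φ := limitResolvent A B
  set g : ℝ≥0∞ → ℝ := fun b => (C * Φ (0, b)).trace with hg
  have hcont : Continuous g := by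
    have h1 : Continuous fun b : ℝ≥0∞ => Φ (0, b) :=
      (continuous_limitResolvent hA hB).comp (by fun_prop)
    exact (continuous_const.matrix_mul h1).matrix_trace
  have hanti : ∀ b b', b ≤ b' → g b' ≤ g b := fun b b' h =>
    trace_mul_le hC (limitResolvent_antitone hA hB ⟨le_rfl, h⟩)
  have hN' : (0 : ℝ) < N := by exact_mod_cast hN
  -- Interior grid points come from the intermediate value theorem. The ends are fixed at `0` and
  -- `∞` so that the cells cover all of `[0, ∞]`; indices beyond `N` are irrelevant.
  have hex : ∀ j : ℕ, ∃ b : ℝ≥0∞, (j ≤ N → g b = g 0 - j / N * (g 0 - g ∞)) ∧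
      (j = 0 → b = 0) ∧ (j = N → b = ∞) := by
    intro j
    rcases Nat.eq_zero_or_pos j with rfl | hj
    · exact ⟨0, by simp, by simp, fun h => by omega⟩
    · by_cases hjN : j < N
      · have hmem : g 0 - j / N * (g 0 - g ∞) ∈ Set.range g := by
          have hle := hanti 0 ∞ bot_le
          have h1 : (j : ℝ) / N ≤ 1 := by
            rw [div_le_one hN']; exact_mod_cast hjN.le
          have h0 : 0 ≤ (j : ℝ) / N := by positivity
          refine mem_range_of_exists_le_of_exists_ge hcont ⟨∞, ?_⟩ ⟨0, ?_⟩ <;> nlinarith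
        obtain ⟨b, hb⟩ := hmem
        exact ⟨b, fun _ => hb, fun h => by omega, fun h => by omega⟩
      · refine ⟨∞, fun h => ?_, fun h => by omega, fun _ => rfl⟩
        have : j = N := by omega
        rw [this, div_self hN'.ne']; ring
  choose b hb hb0 hbN using hex
  have hle : ∀ x y : ℝ≥0∞, x ≤ y → ((0, x) : ℝ≥0∞ × ℝ≥0∞) ≤ (∞, y) := fun x y h => ⟨bot_le, h⟩
  -- The chosen points need not increase when `g` is constant; the maximum keeps the width positive
  -- semidefinite in that case too.
  have hD : ∀ j, (Φ (0, b j) - Φ (∞, max (b j) (b (j + 1)))).PosSemidef := fun j =>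
    limitResolvent_antitone hA hB (hle _ _ (le_max_left _ _))
  have hdrop : ∀ x, (C * (Φ (0, x) - Φ (∞, x))).trace ≤ c * A.rank := fun x =>
    (trace_mul_le_smul hCc (limitResolvent_antitone hA hB (hle x x le_rfl))).trans
      (mul_le_mul_of_nonneg_left (trace_limitResolvent_sub_le_rank hA hB x) hc)
  refine ⟨fun j => Φ (0, b j), fun j => Φ (0, b j) - Φ (∞, max (b j) (b (j + 1))),
    fun j => limitResolvent_posSemidef hA hB _, fun j => one_sub_limitResolvent_posSemidef hA hB _,
    fun j => hD j, fun j => ?_, fun j => ?_, ?_⟩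
  · convert (one_sub_limitResolvent_posSemidef hA hB (0, b j)).add
      (limitResolvent_posSemidef hA hB (∞, max (b j) (b (j + 1)))) using 1
    abel
  · set b' := max (b j) (b (j + 1)) with hb'
    have h1 := hdrop b'
    have hstep : g (b j) - g (b (j + 1)) ≤ C.trace / N := by
      rw [hb j j.2.le, hb (j + 1) j.2]
      have h0 : g 0 ≤ C.trace := by
        simpa using trace_mul_le hC (one_sub_limitResolvent_posSemidef hA hB (0, 0))
      have hi : 0 ≤ g ∞ := trace_mul_nonneg hC (limitResolvent_posSemidef hA hB _)
      push_cast
      calc _ = (g 0 - g ∞) / N := by ring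
        _ ≤ _ := by gcongr; linarith
    have h2 : g (b j) - g b' ≤ C.trace / N := by
      rcases max_choice (b j) (b (j + 1)) with h | h
      · rw [hb', h, sub_self]
        exact div_nonneg hC.trace_nonneg hN'.le
      · rw [hb', h]; exact hstep
    have h3 : (C * (Φ (0, b j) - Φ (∞, b'))).trace =
        (g (b j) - g b') + (C * (Φ (0, b') - Φ (∞, b'))).trace := by
      simp only [hg, Matrix.mul_sub, Matrix.trace_sub]; ring
    rw [h3]; linarith
  · rintro _ ⟨⟨a, x⟩, rfl⟩
    obtain ⟨j, hj, hj1, hj2⟩ := exists_lt_bracket b x N hN (by rw [hb0 0 rfl]; exact bot_le)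
      (by rw [hbN N rfl]; exact le_top)
    refine ⟨⟨j, hj⟩, limitResolvent_antitone hA hB ⟨bot_le, hj1⟩, ?_⟩
    have := limitResolvent_antitone hA hB
      (show ((a, x) : ℝ≥0∞ × ℝ≥0∞) ≤ (∞, max (b j) (b (j + 1))) from
        ⟨le_top, hj2.trans (le_max_right _ _)⟩)
    convert this using 1
    change Φ (0, b j) - Φ (∞, max (b j) (b (j + 1))) - (Φ (0, b j) - Φ (a, x)) = _
    abel

/-- As `exists_isBracketing_limitResolvent`, with the smaller of the two ranks. -/
theorem exists_isBracketing_min_rank (hA : A.PosSemidef) (hB : B.PosSemidef)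
    {C : Matrix n n ℝ} (hC : C.PosSemidef) {c : ℝ} (hc : 0 ≤ c)
    (hCc : (c • (1 : Matrix n n ℝ) - C).PosSemidef) {N : ℕ} (hN : 0 < N) :
    ∃ F D : Fin N → Matrix n n ℝ, IsBracketing (Set.range (limitResolvent A B)) C
      (C.trace / N + c * min A.rank B.rank) F D := by
  rcases min_choice A.rank B.rank with h | h
  · rw [h]; exact exists_isBracketing_limitResolvent hA hB hC hc hCc hN
  · rw [h]
    have hr : Set.range (limitResolvent A B) = Set.range (limitResolvent B A) := by
      ext R
      constructor
      · rintro ⟨⟨a, b⟩, rfl⟩; exact ⟨(b, a), limitResolvent_swap hA hB a b⟩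
      · rintro ⟨⟨b, a⟩, rfl⟩; exact ⟨(a, b), (limitResolvent_swap hA hB a b).symm⟩
    rw [hr]
    exact exists_isBracketing_limitResolvent hB hA hC hc hCc hN

end Bracketing

end CrossClassified

namespace CrossClassified

/-! ### Moments up to order four of quadratic forms in the noise. -/

section Noise

/-- `z` has the moments, up to order four, of a vector of independent centred Gaussian variables of
variance `s`, where `m` is the fourth moment. -/
structure IsNoise {Ω ι : Type*} [MeasurableSpace Ω] [DecidableEq ι] (P : Measure Ω)
    (z : Ω → ι → ℝ) (s m : ℝ) : Prop where
  integrable_two : ∀ e f, Integrable (fun ω => z ω e * z ω f) P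
  integrable_four : ∀ e f g h, Integrable (fun ω => z ω e * z ω f * (z ω g * z ω h)) P
  integral_two : ∀ e f, ∫ ω, z ω e * z ω f ∂P = if e = f then s else 0
  integral_four : ∀ e f g h, ∫ ω, z ω e * z ω f * (z ω g * z ω h) ∂P =
    (if e = f then if g = h then s ^ 2 else 0 else 0) +
    (if e = g then if f = h then s ^ 2 else 0 else 0) +
    (if e = h then if f = g then s ^ 2 else 0 else 0) +
    (if e = f then if e = g then if e = h then m - 3 * s ^ 2 else 0 else 0 else 0)

/-- An index occurring exactly once kills the product, so only the three pairings and the total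
coincidence remain. In the latter all three pairing terms are active and contribute `3 s²`, which
the last term corrects to `m`. -/
theorem prod_moments {ι : Type*} [Fintype ι] [DecidableEq ι] (M : ι → ℕ → ℝ) (s m : ℝ)
    (h0 : ∀ i, M i 0 = 1) (h1 : ∀ i, M i 1 = 0) (h2 : ∀ i, M i 2 = s) (h4 : ∀ i, M i 4 = m)
    (e f g h : ι) :
    ∏ i, M i ((if e = i then 1 else 0) + (if f = i then 1 else 0) + (if g = i then 1 else 0)
      + (if h = i then 1 else 0)) =
    (if e = f then if g = h then s ^ 2 else 0 else 0) +
    (if e = g then if f = h then s ^ 2 else 0 else 0) +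
    (if e = h then if f = g then s ^ 2 else 0 else 0) +
    (if e = f then if e = g then if e = h then m - 3 * s ^ 2 else 0 else 0 else 0) := by
  by_cases hef : e = f
  · subst hef
    by_cases hgh : g = h
    · subst hgh
      by_cases heg : e = g
      · subst heg
        rw [Finset.prod_eq_single e]
        · simp [h4]; ring
        · intro i _ hi; simp [hi.symm, h0]
        · simp
      · rw [Finset.prod_eq_mul e g heg]
        · simp [heg, Ne.symm heg, h2]; ring
        · intro i _ hi; simp [hi.1.symm, hi.2.symm, h0]
        · simp
        · simp
    · by_cases heg : e = g
      · subst heg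
        rw [Finset.prod_eq_zero (Finset.mem_univ h)]
        · simp [hgh]
        · simp [hgh, h1]
      · rw [Finset.prod_eq_zero (Finset.mem_univ g)]
        · simp [hgh, heg]
        · simp [heg, Ne.symm hgh, h1]
  · by_cases heg : e = g
    · subst heg
      by_cases hfh : f = h
      · subst hfh
        rw [Finset.prod_eq_mul e f hef]
        · simp [hef, Ne.symm hef, h2]; ring
        · intro i _ hi; simp [hi.1.symm, hi.2.symm, h0]
        · simp
        · simp
      · rw [Finset.prod_eq_zero (Finset.mem_univ f)]
        · simp [hef, hfh, Ne.symm hef]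
        · simp [hef, Ne.symm hfh, h1]
    · by_cases heh : e = h
      · subst heh
        by_cases hfg : f = g
        · subst hfg
          rw [Finset.prod_eq_mul e f hef]
          · simp [hef, Ne.symm hef, h2]; ring
          · intro i _ hi; simp [hi.1.symm, hi.2.symm, h0]
          · simp
          · simp
        · rw [Finset.prod_eq_zero (Finset.mem_univ f)]
          · simp [hef, hfg, heg]
          · simp [hef, Ne.symm hfg, h1]
      · rw [Finset.prod_eq_zero (Finset.mem_univ e)]
        · simp [hef, heg, heh]
        · simp [Ne.symm hef, Ne.symm heg, Ne.symm heh, h1]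

/-- A product of coordinates is a product over all cells of powers whose exponents count
occurrences, so Fubini factorises its integral. -/
theorem isNoise_pi {ι : Type*} [Fintype ι] [DecidableEq ι] (μ : ι → Measure ℝ)
    [∀ i, IsProbabilityMeasure (μ i)] (ψ : ι → ℝ → ℝ) (s m : ℝ)
    (hint : ∀ i k, Integrable (fun x => ψ i x ^ k) (μ i)) (h1 : ∀ i, ∫ x, ψ i x ∂(μ i) = 0)
    (h2 : ∀ i, ∫ x, ψ i x ^ 2 ∂(μ i) = s) (h4 : ∀ i, ∫ x, ψ i x ^ 4 ∂(μ i) = m) :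
    IsNoise (Measure.pi μ) (fun y i => ψ i (y i)) s m := by
  have e2 : ∀ (e f : ι) (y : ι → ℝ), ψ e (y e) * ψ f (y f) =
      ∏ i, ψ i (y i) ^ ((if e = i then 1 else 0) + (if f = i then 1 else 0)) := by
    intro e f y
    simp only [pow_add, Finset.prod_mul_distrib]
    simp
  have e4 : ∀ (e f g h : ι) (y : ι → ℝ), ψ e (y e) * ψ f (y f) * (ψ g (y g) * ψ h (y h)) =
      ∏ i, ψ i (y i) ^ ((if e = i then 1 else 0) + (if f = i then 1 else 0) +
        (if g = i then 1 else 0) + (if h = i then 1 else 0)) := by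
    intro e f g h y
    simp only [pow_add, Finset.prod_mul_distrib]
    simp [mul_assoc]
  have hM0 : ∀ i, ∫ x, ψ i x ^ 0 ∂(μ i) = 1 := by simp
  have hM1 : ∀ i, ∫ x, ψ i x ^ 1 ∂(μ i) = 0 := by simpa using h1
  refine ⟨fun e f => ?_, fun e f g h => ?_, fun e f => ?_, fun e f g h => ?_⟩
  · simp only [e2]
    exact Integrable.fintype_prod fun i => hint i _
  · simp only [e4]
    exact Integrable.fintype_prod fun i => hint i _
  · simp only [e2]
    rw [integral_fintype_prod_eq_prod (fun i x => ψ i x ^ ((if e = i then 1 else 0) +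
      (if f = i then 1 else 0)))]
    by_cases hef : e = f
    · subst hef
      rw [Finset.prod_eq_single e]
      · simp [h2]
      · intro i _ hi; simp [hi.symm]
      · simp
    · rw [Finset.prod_eq_zero (Finset.mem_univ e)]
      · simp [hef]
      · simp [Ne.symm hef, h1]
  · simp only [e4]
    rw [integral_fintype_prod_eq_prod (fun i x => ψ i x ^ ((if e = i then 1 else 0) +
      (if f = i then 1 else 0) + (if g = i then 1 else 0) + (if h = i then 1 else 0)))]
    exact prod_moments (fun i k => ∫ x, ψ i x ^ k ∂(μ i)) s m hM0 hM1 h2 h4 e f g h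

theorem dotProduct_mulVec_eq_sum {ι : Type*} [Fintype ι] (G : Matrix ι ι ℝ) (x u : ι → ℝ) :
    x ⬝ᵥ (G *ᵥ u) = ∑ e, ∑ f, G e f * (x e * u f) := by
  simp only [dotProduct, Matrix.mulVec, Finset.mul_sum]
  exact Finset.sum_congr rfl fun e _ => Finset.sum_congr rfl fun f _ => by ring

theorem quadForm_sq_eq_sum {ι : Type*} [Fintype ι] (G : Matrix ι ι ℝ) (x : ι → ℝ) :
    (x ⬝ᵥ (G *ᵥ x)) ^ 2 =
      ∑ e, ∑ f, ∑ g, ∑ h, G e f * G g h * (x e * x f * (x g * x h)) := by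
  rw [dotProduct_mulVec_eq_sum, pow_two, Finset.sum_mul]
  refine Finset.sum_congr rfl fun e _ => ?_
  rw [Finset.sum_mul]
  refine Finset.sum_congr rfl fun f _ => ?_
  rw [Finset.mul_sum]
  refine Finset.sum_congr rfl fun g _ => ?_
  rw [Finset.mul_sum]
  exact Finset.sum_congr rfl fun h _ => by ring

variable {Ω ι : Type*} [MeasurableSpace Ω] [Fintype ι] [DecidableEq ι] {P : Measure Ω} {z : Ω → ι → ℝ} {s m : ℝ} (hz : IsNoise P z s m)

include hz

theorem IsNoise.integrable_quadForm (G : Matrix ι ι ℝ) :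
    Integrable (fun ω => z ω ⬝ᵥ (G *ᵥ z ω)) P := by
  simp only [dotProduct_mulVec_eq_sum]
  exact integrable_finsetSum _ fun e _ => integrable_finsetSum _ fun f _ =>
    (hz.integrable_two e f).const_mul _

theorem IsNoise.integral_quadForm (G : Matrix ι ι ℝ) :
    ∫ ω, z ω ⬝ᵥ (G *ᵥ z ω) ∂P = s * G.trace := by
  simp only [dotProduct_mulVec_eq_sum]
  have i1 := fun e f => (hz.integrable_two e f).const_mul (G e f)
  have i2 := fun e => integrable_finsetSum Finset.univ fun f _ => i1 e f
  rw [integral_finsetSum _ fun e _ => i2 e]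
  simp_rw [integral_finsetSum _ fun f _ => i1 _ f, integral_const_mul, hz.integral_two]
  simp [Matrix.trace, Finset.mul_sum, mul_comm]

theorem IsNoise.integrable_dotProduct_sq (v : ι → ℝ) : Integrable (fun ω => (z ω ⬝ᵥ v) ^ 2) P := by
  have : ∀ ω, (z ω ⬝ᵥ v) ^ 2 = z ω ⬝ᵥ (Matrix.vecMulVec v v *ᵥ z ω) := by
    intro ω
    rw [Matrix.vecMulVec_mulVec, dotProduct_smul, dotProduct_comm v]
    simp [pow_two]
  simp only [this]
  exact hz.integrable_quadForm _

theorem IsNoise.integral_dotProduct_sq (v : ι → ℝ) : ∫ ω, (z ω ⬝ᵥ v) ^ 2 ∂P = s * (v ⬝ᵥ v) := by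
  have : ∀ ω, (z ω ⬝ᵥ v) ^ 2 = z ω ⬝ᵥ (Matrix.vecMulVec v v *ᵥ z ω) := by
    intro ω
    rw [Matrix.vecMulVec_mulVec, dotProduct_smul, dotProduct_comm v]
    simp [pow_two]
  simp only [this]
  rw [hz.integral_quadForm, Matrix.trace_vecMulVec]

theorem IsNoise.integrable_quadForm_sq (G : Matrix ι ι ℝ) :
    Integrable (fun ω => (z ω ⬝ᵥ (G *ᵥ z ω)) ^ 2) P := by
  simp only [quadForm_sq_eq_sum]
  exact integrable_finsetSum _ fun e _ => integrable_finsetSum _ fun f _ =>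
    integrable_finsetSum _ fun g _ => integrable_finsetSum _ fun h _ =>
    (hz.integrable_four e f g h).const_mul _

theorem IsNoise.integral_quadForm_sq (G : Matrix ι ι ℝ) :
    ∫ ω, (z ω ⬝ᵥ (G *ᵥ z ω)) ^ 2 ∂P = s ^ 2 * G.trace ^ 2 + s ^ 2 * (∑ e, ∑ f, G e f ^ 2) +
      s ^ 2 * (∑ e, ∑ f, G e f * G f e) + (m - 3 * s ^ 2) * ∑ e, G e e ^ 2 := by
  simp only [quadForm_sq_eq_sum]
  have i1 := fun e f g h => (hz.integrable_four e f g h).const_mul (G e f * G g h)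
  have i2 := fun e f g => integrable_finsetSum Finset.univ fun h _ => i1 e f g h
  have i3 := fun e f => integrable_finsetSum Finset.univ fun g _ => i2 e f g
  have i4 := fun e => integrable_finsetSum Finset.univ fun f _ => i3 e f
  rw [integral_finsetSum _ fun e _ => i4 e]
  simp_rw [integral_finsetSum _ fun f _ => i3 _ f, integral_finsetSum _ fun g _ => i2 _ _ g,
    integral_finsetSum _ fun h _ => i1 _ _ _ h, integral_const_mul, hz.integral_four, mul_add,
    Finset.sum_add_distrib]
  congr 1
  · congr 1
    · congr 1
      · simp [Matrix.trace, pow_two, Finset.mul_sum, mul_comm, mul_left_comm]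
      · simp [Finset.mul_sum, mul_comm, pow_two]
    · simp [Finset.mul_sum, mul_comm, pow_two]
  · simp [Finset.mul_sum, mul_comm, pow_two]

theorem IsNoise.integrable_quadForm_sub_sq [IsProbabilityMeasure P] (G : Matrix ι ι ℝ) (t : ℝ) :
    Integrable (fun ω => (z ω ⬝ᵥ (G *ᵥ z ω) - t) ^ 2) P := by
  have : ∀ ω, (z ω ⬝ᵥ (G *ᵥ z ω) - t) ^ 2 =
      (z ω ⬝ᵥ (G *ᵥ z ω)) ^ 2 - 2 * t * (z ω ⬝ᵥ (G *ᵥ z ω)) + t ^ 2 := fun ω => by ring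
  simp only [this]
  exact ((hz.integrable_quadForm_sq G).sub ((hz.integrable_quadForm G).const_mul _)).add
    (integrable_const _)

/-- The exact variance has a Frobenius term, a transposed cross term bounded by it, and a diagonal
term whose `-3 s²` part is dropped. Symmetry of `G` is not needed, which matters for `G = V F`. -/
theorem IsNoise.integral_quadForm_sub_sq_le [IsProbabilityMeasure P] (hm : 0 ≤ m) (G : Matrix ι ι ℝ) :
    ∫ ω, (z ω ⬝ᵥ (G *ᵥ z ω) - s * G.trace) ^ 2 ∂P ≤ (2 * s ^ 2 + m) * (G * Gᵀ).trace := by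
  have hF : (G * Gᵀ).trace = ∑ e, ∑ f, G e f ^ 2 := by
    simp [Matrix.trace, Matrix.mul_apply, pow_two]
  have : ∀ ω, (z ω ⬝ᵥ (G *ᵥ z ω) - s * G.trace) ^ 2 =
      (z ω ⬝ᵥ (G *ᵥ z ω)) ^ 2 - 2 * (s * G.trace) * (z ω ⬝ᵥ (G *ᵥ z ω)) + (s * G.trace) ^ 2 :=
    fun ω => by ring
  simp only [this]
  have i1 := hz.integrable_quadForm_sq G
  have i2 := (hz.integrable_quadForm G).const_mul (2 * (s * G.trace))
  have i3 : Integrable (fun ω => (z ω ⬝ᵥ (G *ᵥ z ω)) ^ 2 -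
    2 * (s * G.trace) * (z ω ⬝ᵥ (G *ᵥ z ω))) P := i1.sub i2
  rw [integral_add i3 (integrable_const _), integral_sub i1 i2, integral_const_mul,
    hz.integral_quadForm, hz.integral_quadForm_sq, integral_const, hF]
  have hcross : ∑ e, ∑ f, G e f * G f e ≤ ∑ e, ∑ f, G e f ^ 2 := by
    have h1 : ∑ e, ∑ f, G f e ^ 2 = ∑ e, ∑ f, G e f ^ 2 := Finset.sum_comm
    have h2 : ∑ e, ∑ f, G e f * G f e ≤ ∑ e, ∑ f, (G e f ^ 2 + G f e ^ 2) / 2 :=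
      Finset.sum_le_sum fun e _ => Finset.sum_le_sum fun f _ => by
        nlinarith [sq_nonneg (G e f - G f e)]
    have h3 : ∑ e, ∑ f, (G e f ^ 2 + G f e ^ 2) / 2 =
        (∑ e, ∑ f, G e f ^ 2 + ∑ e, ∑ f, G f e ^ 2) / 2 := by
      simp only [← Finset.sum_div, Finset.sum_add_distrib]
    rw [h3, h1] at h2
    linarith
  have hdiag : ∑ e, G e e ^ 2 ≤ ∑ e, ∑ f, G e f ^ 2 :=
    Finset.sum_le_sum fun e _ => Finset.single_le_sum (f := fun f => G e f ^ 2)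
      (fun f _ => sq_nonneg _) (Finset.mem_univ e)
  have hdiag0 : 0 ≤ ∑ e, G e e ^ 2 := Finset.sum_nonneg fun e _ => sq_nonneg _
  simp only [probReal_univ, smul_eq_mul, one_mul]
  nlinarith [mul_le_mul_of_nonneg_left hcross (sq_nonneg s), mul_le_mul_of_nonneg_left hdiag hm,
    mul_nonneg (sq_nonneg s) hdiag0]

end Noise

end CrossClassified

namespace CrossClassified

section Spectral

variable {n : Type*} [Fintype n]

theorem dotProduct_mulVec_self_eq {m : Type*} [Fintype m] (Y : Matrix m n ℝ) (v : n → ℝ) :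
    (Y *ᵥ v) ⬝ᵥ (Y *ᵥ v) = v ⬝ᵥ ((Yᵀ * Y) *ᵥ v) := by
  rw [← Matrix.mulVec_mulVec, Matrix.mulVec_transpose, dotProduct_comm v,
    ← Matrix.dotProduct_mulVec]

variable [DecidableEq n]

theorem maxEigenvalue_smul_one_sub_posSemidef {Q : Matrix n n ℝ} (hQ : Q.PosSemidef) :
    (maxEigenvalue Q • (1 : Matrix n n ℝ) - Q).PosSemidef := by
  have hle : ∀ x ∈ spectrum ℝ Q, x ≤ maxEigenvalue Q := by
    intro x hx
    refine le_csSup ?_ hx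
    rw [hQ.isHermitian.spectrum_real_eq_range_eigenvalues]
    exact (Set.finite_range _).bddAbove
  open scoped MatrixOrder in
  have h := le_algebraMap_of_spectrum_le hle hQ.isHermitian
  rw [Algebra.algebraMap_eq_smul_one] at h
  exact Matrix.le_iff.1 h

theorem maxEigenvalue_nonneg {Q : Matrix n n ℝ} (hQ : Q.PosSemidef) : 0 ≤ maxEigenvalue Q := by
  refine Real.sSup_nonneg fun x hx => ?_
  rw [hQ.isHermitian.spectrum_real_eq_range_eigenvalues] at hx
  obtain ⟨i, rfl⟩ := hx
  exact hQ.eigenvalues_nonneg i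

end Spectral

/-! ### The model in whitened coordinates. -/

section Model

variable {r c : ℕ} (k : Fin r → Fin c → ℕ)

/-- `M^{1/2}`. -/
noncomputable def noiseRoot : Matrix (Obs k) (Obs k) ℝ :=
  Matrix.diagonal fun e => (√(k e.1.1 e.1.2 : ℝ))⁻¹

/-- `M^{-1/2}`. -/
noncomputable def noiseRootInv : Matrix (Obs k) (Obs k) ℝ :=
  Matrix.diagonal fun e => √(k e.1.1 e.1.2 : ℝ)

theorem count_pos (e : Obs k) : (0 : ℝ) < k e.1.1 e.1.2 := by exact_mod_cast e.2

theorem sqrt_count_ne_zero (e : Obs k) : √(k e.1.1 e.1.2 : ℝ) ≠ 0 :=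
  (Real.sqrt_pos.2 (count_pos k e)).ne'

theorem noiseRoot_mul_noiseRootInv : noiseRoot k * noiseRootInv k = 1 := by
  rw [noiseRoot, noiseRootInv, Matrix.diagonal_mul_diagonal, ← Matrix.diagonal_one]
  congr 1; ext e
  exact inv_mul_cancel₀ (sqrt_count_ne_zero k e)

theorem noiseRootInv_mul_noiseRoot : noiseRootInv k * noiseRoot k = 1 := by
  rw [noiseRoot, noiseRootInv, Matrix.diagonal_mul_diagonal, ← Matrix.diagonal_one]
  congr 1; ext e
  exact mul_inv_cancel₀ (sqrt_count_ne_zero k e)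

theorem noiseRoot_mul_self : noiseRoot k * noiseRoot k = noiseCov k := by
  rw [noiseRoot, noiseCov, Matrix.diagonal_mul_diagonal]
  congr 1; ext e
  rw [← mul_inv, Real.mul_self_sqrt (count_pos k e).le]

theorem noiseRoot_transpose : (noiseRoot k)ᵀ = noiseRoot k := Matrix.diagonal_transpose _

theorem noiseRootInv_transpose : (noiseRootInv k)ᵀ = noiseRootInv k := Matrix.diagonal_transpose _

/-- The row part of the design matrix, in whitened coordinates. -/
noncomputable def rowDesign : Matrix (Obs k) (Fin r) ℝ :=
  noiseRootInv k * (design k).submatrix id Sum.inl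

/-- The column part of the design matrix, in whitened coordinates. -/
noncomputable def colDesign : Matrix (Obs k) (Fin c) ℝ :=
  noiseRootInv k * (design k).submatrix id Sum.inr

/-- The row part of the between-cell covariance, in whitened coordinates. -/
noncomputable def rowCov : Matrix (Obs k) (Obs k) ℝ := rowDesign k * (rowDesign k)ᵀ

/-- The column part of the between-cell covariance, in whitened coordinates. -/
noncomputable def colCov : Matrix (Obs k) (Obs k) ℝ := colDesign k * (colDesign k)ᵀ

theorem rowCov_posSemidef : (rowCov k).PosSemidef := by
  have := Matrix.posSemidef_self_mul_conjTranspose (rowDesign k)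
  rwa [Matrix.conjTranspose_eq_transpose_of_trivial] at this

theorem colCov_posSemidef : (colCov k).PosSemidef := by
  have := Matrix.posSemidef_self_mul_conjTranspose (colDesign k)
  rwa [Matrix.conjTranspose_eq_transpose_of_trivial] at this

theorem rank_rowCov_le : (rowCov k).rank ≤ r :=
  (Matrix.rank_mul_le_left _ _).trans ((Matrix.rank_le_card_width _).trans (by simp))

theorem rank_colCov_le : (colCov k).rank ≤ c :=
  (Matrix.rank_mul_le_left _ _).trans ((Matrix.rank_le_card_width _).trans (by simp))

/-- The block diagonal `Λ Λᵀ` separates rows from columns, so the covariance depends on the variance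
ratios only through a linear combination of two fixed matrices. -/
theorem margCov_eq {a b : ℝ} (ha : 0 ≤ a) (hb : 0 ≤ b) :
    margCov k a b = noiseRoot k * (1 + a • rowCov k + b • colCov k) * noiseRoot k := by
  have h1 : design k * effectScale r c a b * (effectScale r c a b)ᵀ * (design k)ᵀ =
      a • ((design k).submatrix id Sum.inl * ((design k).submatrix id Sum.inl)ᵀ) +
      b • ((design k).submatrix id Sum.inr * ((design k).submatrix id Sum.inr)ᵀ) := by
    have hΛ : effectScale r c a b * (effectScale r c a b)ᵀ =
        Matrix.diagonal (Sum.elim (fun _ => a) (fun _ => b)) := by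
      rw [effectScale, Matrix.diagonal_transpose, Matrix.diagonal_mul_diagonal]
      congr 1; ext s
      rcases s with i | j
      · exact Real.mul_self_sqrt ha
      · exact Real.mul_self_sqrt hb
    rw [Matrix.mul_assoc (design k), hΛ]
    ext e f
    rw [Matrix.mul_apply, Fintype.sum_sum_type]
    simp only [Matrix.mul_diagonal]
    simp only [Matrix.mul_apply, Matrix.transpose_apply, Sum.elim_inl,
      Sum.elim_inr, Matrix.add_apply, Matrix.smul_apply, Matrix.submatrix_apply, id, smul_eq_mul,
      Finset.mul_sum]
    congr 1 <;> exact Finset.sum_congr rfl fun i _ => by ring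
  have h2 : ∀ {m : Type} [Fintype m] (Y : Matrix (Obs k) m ℝ),
      noiseRoot k * ((noiseRootInv k * Y) * (noiseRootInv k * Y)ᵀ) * noiseRoot k = Y * Yᵀ := by
    intro m _ Y
    rw [Matrix.transpose_mul, noiseRootInv_transpose]
    calc _ = (noiseRoot k * noiseRootInv k) * Y * Yᵀ * (noiseRootInv k * noiseRoot k) := by
          simp only [Matrix.mul_assoc]
      _ = _ := by rw [noiseRoot_mul_noiseRootInv, noiseRootInv_mul_noiseRoot, Matrix.one_mul,
        Matrix.mul_one]
  rw [margCov, h1, Matrix.mul_add, Matrix.add_mul, Matrix.mul_add, Matrix.add_mul, Matrix.mul_one,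
    noiseRoot_mul_self, Matrix.mul_smul, Matrix.smul_mul, Matrix.mul_smul, Matrix.smul_mul,
    rowCov, colCov, rowDesign, colDesign, h2, h2]
  abel

theorem inv_margCov_eq {a b : ℝ} (ha : 0 ≤ a) (hb : 0 ≤ b) :
    (margCov k a b)⁻¹ =
      noiseRootInv k * resolvent (rowCov k) (colCov k) a b * noiseRootInv k := by
  have h : (noiseRoot k)⁻¹ = noiseRootInv k :=
    Matrix.inv_eq_left_inv (noiseRootInv_mul_noiseRoot k)
  rw [margCov_eq k ha hb, Matrix.mul_inv_rev, Matrix.mul_inv_rev, h, resolvent, Matrix.mul_assoc]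

/-- The precision matrix in whitened coordinates, `M^{1/2} Σ⁻¹ M^{1/2}`. -/
noncomputable def whitePrecision : ℝ≥0∞ × ℝ≥0∞ → Matrix (Obs k) (Obs k) ℝ :=
  limitResolvent (rowCov k) (colCov k)

/-- Conjugation by a fixed matrix is continuous, so it commutes with the extension to infinite
ratios. -/
theorem precision_eq (l : ℝ≥0∞ × ℝ≥0∞) :
    precision k l = noiseRootInv k * whitePrecision k l * noiseRootInv k := by
  refine extendFrom_eq (dense_finitePairs l) ?_
  simp only [inv_margCov_eq k ENNReal.toReal_nonneg ENNReal.toReal_nonneg]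
  have hcont : Continuous fun R : Matrix (Obs k) (Obs k) ℝ =>
      noiseRootInv k * R * noiseRootInv k :=
    (continuous_const.matrix_mul continuous_id).matrix_mul continuous_const
  exact (hcont.tendsto _).comp (tendsto_limitResolvent (rowCov_posSemidef k) (colCov_posSemidef k) l)

/-- The loss matrix in whitened coordinates, `M^{1/2} Q M^{1/2}`. -/
noncomputable def whiteLoss : Matrix (Obs k) (Obs k) ℝ :=
  noiseRoot k * lossMatrix k * noiseRoot k

theorem lossMatrix_posSemidef : (lossMatrix k).PosSemidef := by
  have := Matrix.posSemidef_conjTranspose_mul_self (cellMap k)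
  rwa [Matrix.conjTranspose_eq_transpose_of_trivial] at this

theorem whiteLoss_posSemidef : (whiteLoss k).PosSemidef :=
  posSemidef_conj (lossMatrix_posSemidef k) (noiseRoot_transpose k)

/-- The whitened noise `M^{-1/2} (y - η)`. -/
noncomputable def whiteNoise (η : Fin r × Fin c → ℝ) (y : Obs k → ℝ) : Obs k → ℝ :=
  noiseRootInv k *ᵥ (y - fun e => η e.1)

/-- The whitened residual `M^{-1/2} (y - 1 μ)`. -/
noncomputable def whiteResid (μ : ℝ) (y : Obs k → ℝ) : Obs k → ℝ :=
  noiseRootInv k *ᵥ (y - fun _ => μ)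

variable {k}

/-- The constant `m` is absorbed into the row effects, so the means lie in the range of `Z_c = B Z`;
then `B Z Z† Z = B Z`. This is where estimability makes the error over all cells a linear image of
the error over the observed ones. -/
theorem cellMap_mulVec_cellMeans (hk : IsEstimable k) (m : ℝ) (α : Fin r → ℝ)
    (β : Fin c → ℝ) :
    cellMap k *ᵥ (fun e => cellMeans m α β e.1) = cellMeans m α β := by
  obtain ⟨B, hB⟩ := hk
  have hη : cellMeans m α β = fullDesign r c *ᵥ Sum.elim (fun i => α i + m) β := by
    ext p
    simp [cellMeans, fullDesign, Matrix.mulVec, dotProduct, Fintype.sum_sum_type]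
    ring
  have hE : (fun e : Obs k => cellMeans m α β e.1) =
      design k *ᵥ Sum.elim (fun i => α i + m) β := by
    ext e; rw [hη]; rfl
  rw [hE, hη, Matrix.mulVec_mulVec, cellMap]
  congr 1
  rw [← hB, Matrix.mul_assoc, Matrix.mul_assoc, ← Matrix.mul_assoc (design k),
    (pinv_spec (design k)).left]

theorem noiseRoot_mulVec_whiteNoise (η : Fin r × Fin c → ℝ) (y : Obs k → ℝ) :
    noiseRoot k *ᵥ whiteNoise k η y = y - fun e => η e.1 := by
  rw [whiteNoise, Matrix.mulVec_mulVec, noiseRoot_mul_noiseRootInv, Matrix.one_mulVec]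

theorem shrinkEst_sub_eq (η : Fin r × Fin c → ℝ) (t : ℝ × ℝ≥0∞ × ℝ≥0∞) (y : Obs k → ℝ) :
    (shrinkEst k t y - fun e => η e.1) = noiseRoot k *ᵥ
      (whiteNoise k η y - whitePrecision k t.2 *ᵥ whiteResid k t.1 y) := by
  rw [Matrix.mulVec_sub, noiseRoot_mulVec_whiteNoise, shrinkEst, precision_eq, whiteResid,
    Matrix.mulVec_mulVec, Matrix.mulVec_mulVec, ← noiseRoot_mul_self]
  have : noiseRoot k * noiseRoot k * (noiseRootInv k * whitePrecision k t.2 * noiseRootInv k) =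
      noiseRoot k * whitePrecision k t.2 * noiseRootInv k := by
    rw [Matrix.mul_assoc (noiseRoot k) (whitePrecision k t.2)]
    calc _ = noiseRoot k * (noiseRoot k * noiseRootInv k) * (whitePrecision k t.2 * noiseRootInv k) := by
          simp only [Matrix.mul_assoc]
      _ = _ := by rw [noiseRoot_mul_noiseRootInv, Matrix.mul_one]
  rw [this]
  abel

theorem loss_cellEst_eq {η : Fin r × Fin c → ℝ} (hη : cellMap k *ᵥ (fun e => η e.1) = η)
    (t : ℝ × ℝ≥0∞ × ℝ≥0∞) (y : Obs k → ℝ) :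
    loss η (cellEst k t y) = ((r : ℝ) * c)⁻¹ *
      ((whiteNoise k η y - whitePrecision k t.2 *ᵥ whiteResid k t.1 y) ⬝ᵥ (whiteLoss k *ᵥ
        (whiteNoise k η y - whitePrecision k t.2 *ᵥ whiteResid k t.1 y))) := by
  set v := whiteNoise k η y - whitePrecision k t.2 *ᵥ whiteResid k t.1 y with hv
  have h1 : cellEst k t y - η = cellMap k *ᵥ (noiseRoot k *ᵥ v) := by
    rw [hv, ← shrinkEst_sub_eq, Matrix.mulVec_sub, hη, cellEst]
  have h2 : ∑ p, (cellEst k t y p - η p) ^ 2 = (cellEst k t y - η) ⬝ᵥ (cellEst k t y - η) := by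
    simp [dotProduct, pow_two]
  rw [loss, h2, h1, Matrix.mulVec_mulVec, dotProduct_mulVec_self_eq, whiteLoss, lossMatrix,
    Matrix.transpose_mul, noiseRoot_transpose]
  simp only [Matrix.mul_assoc]

theorem ure_eq (σ : ℝ) (t : ℝ × ℝ≥0∞ × ℝ≥0∞) (y : Obs k → ℝ) :
    ure k σ t y = ((r : ℝ) * c)⁻¹ * (σ ^ 2 * (whiteLoss k).trace
      - 2 * σ ^ 2 * (whiteLoss k * whitePrecision k t.2).trace
      + (whitePrecision k t.2 *ᵥ whiteResid k t.1 y) ⬝ᵥ (whiteLoss k *ᵥ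
        (whitePrecision k t.2 *ᵥ whiteResid k t.1 y))) := by
  have hW := noiseRootInv_mul_noiseRoot k
  have hW' := noiseRoot_mul_noiseRootInv k
  have e1 : (lossMatrix k * noiseCov k).trace = (whiteLoss k).trace := by
    rw [whiteLoss, Matrix.trace_mul_cycle, noiseRoot_mul_self, Matrix.trace_mul_comm]
  have e0 : precision k t.2 * noiseCov k = noiseRootInv k * whitePrecision k t.2 * noiseRoot k := by
    rw [precision_eq, ← noiseRoot_mul_self]
    calc _ = noiseRootInv k * whitePrecision k t.2 * (noiseRootInv k * noiseRoot k) * noiseRoot k := by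
          simp only [Matrix.mul_assoc]
      _ = _ := by rw [hW, Matrix.mul_one]
  have e0' : noiseCov k * precision k t.2 = noiseRoot k * whitePrecision k t.2 * noiseRootInv k := by
    rw [precision_eq, ← noiseRoot_mul_self]
    calc _ = noiseRoot k * (noiseRoot k * noiseRootInv k) * whitePrecision k t.2 * noiseRootInv k := by
          simp only [Matrix.mul_assoc]
      _ = _ := by rw [hW', Matrix.mul_one]
  have e2 : (precision k t.2 * noiseCov k * lossMatrix k * noiseCov k).trace =
      (whiteLoss k * whitePrecision k t.2).trace := by
    rw [e0, ← noiseRoot_mul_self]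
    have : noiseRootInv k * whitePrecision k t.2 * noiseRoot k * lossMatrix k *
        (noiseRoot k * noiseRoot k) =
        (noiseRootInv k * whitePrecision k t.2) * (whiteLoss k * noiseRoot k) := by
      rw [whiteLoss]; simp only [Matrix.mul_assoc]
    have h' : whiteLoss k * noiseRoot k * (noiseRootInv k * whitePrecision k t.2) =
        whiteLoss k * whitePrecision k t.2 := by
      rw [Matrix.mul_assoc, ← Matrix.mul_assoc (noiseRoot k), hW', Matrix.one_mul]
    rw [this, Matrix.trace_mul_comm, h']
  have hP : (whitePrecision k t.2)ᵀ = whitePrecision k t.2 := transpose_eq_of_posSemidef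
    (limitResolvent_posSemidef (rowCov_posSemidef k) (colCov_posSemidef k) t.2)
  have e3 : precision k t.2 * noiseCov k * lossMatrix k * noiseCov k * precision k t.2 =
      (whitePrecision k t.2 * noiseRootInv k)ᵀ * (whiteLoss k *
        (whitePrecision k t.2 * noiseRootInv k)) := by
    rw [Matrix.mul_assoc (precision k t.2 * noiseCov k * lossMatrix k), e0', e0,
      Matrix.transpose_mul, noiseRootInv_transpose, hP, whiteLoss]
    simp only [Matrix.mul_assoc]
  have e4 : (y - fun _ => t.1) ⬝ᵥ (((whitePrecision k t.2 * noiseRootInv k)ᵀ * (whiteLoss k *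
        (whitePrecision k t.2 * noiseRootInv k))) *ᵥ (y - fun _ => t.1)) =
      (whitePrecision k t.2 *ᵥ whiteResid k t.1 y) ⬝ᵥ (whiteLoss k *ᵥ
        (whitePrecision k t.2 *ᵥ whiteResid k t.1 y)) := by
    rw [whiteResid, ← Matrix.mulVec_mulVec, ← Matrix.mulVec_mulVec, Matrix.mulVec_transpose,
      dotProduct_comm, ← Matrix.dotProduct_mulVec, dotProduct_comm]
    simp only [Matrix.mulVec_mulVec]
  rw [ure, e1, e2, e3, e4]

/-- The difference between the risk estimate and the loss. -/
theorem ure_sub_loss_eq (σ : ℝ) {η : Fin r × Fin c → ℝ}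
    (hη : cellMap k *ᵥ (fun e => η e.1) = η) (t : ℝ × ℝ≥0∞ × ℝ≥0∞) (y : Obs k → ℝ) :
    ure k σ t y - loss η (cellEst k t y) = ((r : ℝ) * c)⁻¹ *
      (2 * ((whiteNoise k η y) ⬝ᵥ ((whiteLoss k * whitePrecision k t.2) *ᵥ whiteResid k t.1 y)
          - σ ^ 2 * (whiteLoss k * whitePrecision k t.2).trace)
        - (whiteNoise k η y ⬝ᵥ (whiteLoss k *ᵥ whiteNoise k η y) - σ ^ 2 * (whiteLoss k).trace)) := by
  rw [ure_eq, loss_cellEst_eq hη]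
  have hV := transpose_eq_of_posSemidef (whiteLoss_posSemidef k)
  rw [← Matrix.mulVec_mulVec]
  set v := whitePrecision k t.2 *ᵥ whiteResid k t.1 y
  set z := whiteNoise k η y
  have := dotProduct_mulVec_comm_of_symm hV z v
  -- The terms quadratic in `v` cancel; the cross term and the pure noise term remain, each with its
  -- centring.
  rw [Matrix.mulVec_sub, dotProduct_sub, sub_dotProduct, sub_dotProduct, this]
  ring

end Model

end CrossClassified

namespace CrossClassified

/-! ### Uniform deviation bound over a bracketed family. -/

section UniformBound

theorem two_mul_abs_le {κ : ℝ} (hκ : 0 < κ) (x : ℝ) : 2 * |x| ≤ κ + x ^ 2 / κ := by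
  have : 2 * |x| * κ ≤ (κ + x ^ 2 / κ) * κ := by
    rw [add_mul, div_mul_cancel₀ _ hκ.ne', ← sq_abs x]
    nlinarith [sq_nonneg (|x| - κ)]
  exact le_of_mul_le_mul_right this hκ

variable {ι : Type*} [Fintype ι] [DecidableEq ι]

theorem dotProduct_self_nonneg_real {n : Type*} [Fintype n] (x : n → ℝ) : 0 ≤ x ⬝ᵥ x :=
  Finset.sum_nonneg fun _ _ => mul_self_nonneg _

theorem one_sub_sq_posSemidef {F : Matrix ι ι ℝ} (hF : F.PosSemidef) (hF1 : (1 - F).PosSemidef) :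
    (1 - F * F).PosSemidef := by
  have h := smul_self_sub_sq_posSemidef zero_le_one hF (by simpa using hF1)
  convert hF1.add h using 1
  rw [one_smul]; abel

theorem sq_smul_one_sub_sq_posSemidef {V : Matrix ι ι ℝ} {ℓ : ℝ} (hℓ : 0 ≤ ℓ) (hV : V.PosSemidef)
    (hVℓ : (ℓ • (1 : Matrix ι ι ℝ) - V).PosSemidef) :
    (ℓ ^ 2 • (1 : Matrix ι ι ℝ) - V * V).PosSemidef := by
  convert (hVℓ.smul hℓ).add (smul_self_sub_sq_posSemidef hℓ hV hVℓ) using 1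
  rw [smul_sub, smul_smul, pow_two]; abel

theorem dotProduct_mulVec_self_le {V : Matrix ι ι ℝ} {ℓ : ℝ} (hℓ : 0 ≤ ℓ) (hV : V.PosSemidef)
    (hVℓ : (ℓ • (1 : Matrix ι ι ℝ) - V).PosSemidef) (x : ι → ℝ) :
    (V *ᵥ x) ⬝ᵥ (V *ᵥ x) ≤ ℓ ^ 2 * (x ⬝ᵥ x) := by
  rw [dotProduct_mulVec_self_eq, transpose_eq_of_posSemidef hV, ← quadForm_smul_one]
  exact quadForm_le (sq_smul_one_sub_sq_posSemidef hℓ hV hVℓ) x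

theorem trace_le_smul_card {V : Matrix ι ι ℝ} {ℓ : ℝ}
    (hVℓ : (ℓ • (1 : Matrix ι ι ℝ) - V).PosSemidef) : V.trace ≤ ℓ * Fintype.card ι := by
  have := trace_le hVℓ
  rwa [Matrix.trace_smul, Matrix.trace_one, smul_eq_mul] at this

/-- By cyclicity this is `tr (V² F²)`, with `F² ≤ 1` and `V² ≤ ℓ²`: the Frobenius norm that governs
the variances at the bracket ends. -/
theorem trace_mul_transpose_le {V F : Matrix ι ι ℝ} {ℓ : ℝ} (hℓ : 0 ≤ ℓ) (hV : V.PosSemidef)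
    (hVℓ : (ℓ • (1 : Matrix ι ι ℝ) - V).PosSemidef) (hF : F.PosSemidef)
    (hF1 : (1 - F).PosSemidef) : ((V * F) * (V * F)ᵀ).trace ≤ ℓ ^ 2 * Fintype.card ι := by
  have hVt := transpose_eq_of_posSemidef hV
  rw [Matrix.transpose_mul, transpose_eq_of_posSemidef hF, hVt]
  calc (V * F * (F * V)).trace = (V * V * (F * F)).trace := by
        rw [← Matrix.mul_assoc, Matrix.trace_mul_comm]; simp only [Matrix.mul_assoc]
    _ ≤ (V * V * 1).trace := trace_mul_le (posSemidef_mul_self hVt) (one_sub_sq_posSemidef hF hF1)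
    _ ≤ ℓ ^ 2 * Fintype.card ι := by
        rw [Matrix.mul_one]
        exact trace_le_smul_card (sq_smul_one_sub_sq_posSemidef hℓ hV hVℓ)

theorem trace_conj_mul_transpose_le {V D : Matrix ι ι ℝ} {ℓ : ℝ} (hℓ : 0 ≤ ℓ) (hV : V.PosSemidef)
    (hVℓ : (ℓ • (1 : Matrix ι ι ℝ) - V).PosSemidef) (hD : D.PosSemidef)
    (hD1 : (1 - D).PosSemidef) :
    ((V * D * V) * (V * D * V)ᵀ).trace ≤ ℓ ^ 4 * Fintype.card ι := by
  have hVt := transpose_eq_of_posSemidef hV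
  have hDt := transpose_eq_of_posSemidef hD
  have h2 := sq_smul_one_sub_sq_posSemidef hℓ hV hVℓ
  have ht : (V * D * V)ᵀ = V * D * V := by
    simp only [Matrix.transpose_mul, hVt, hDt, Matrix.mul_assoc]
  calc ((V * D * V) * (V * D * V)ᵀ).trace = (V * V * (D * (V * V) * D)).trace := by
        rw [ht, ← Matrix.mul_assoc, Matrix.trace_mul_comm]; simp only [Matrix.mul_assoc]
    _ ≤ ℓ ^ 2 * (D * (V * V) * D).trace :=
        trace_mul_le_smul h2 (posSemidef_conj (posSemidef_mul_self hVt) hDt)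
    _ = ℓ ^ 2 * ((V * D) * (V * D)ᵀ).trace := by
        rw [Matrix.transpose_mul, hVt, hDt, Matrix.trace_mul_comm (V * D)]
        simp only [Matrix.mul_assoc]
    _ ≤ ℓ ^ 2 * (ℓ ^ 2 * Fintype.card ι) :=
        mul_le_mul_of_nonneg_left (trace_mul_transpose_le hℓ hV hVℓ hD hD1) (sq_nonneg _)
    _ = ℓ ^ 4 * Fintype.card ι := by ring

variable {Ω : Type*} [MeasurableSpace Ω] {P : Measure Ω} [IsProbabilityMeasure P]
  {z : Ω → ι → ℝ} {s m : ℝ}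

/-- The deviation of the bilinear form `zᵀ V R (z + p - μ o)` from its mean is bounded, uniformly
in `μ` and in `R` from a bracketed family. -/
theorem exists_uniform_bound (hz : IsNoise P z s m) (hs : 0 ≤ s) (hm : 0 ≤ m)
    {V : Matrix ι ι ℝ} {ℓ : ℝ} (hℓ : 0 ≤ ℓ) (hV : V.PosSemidef)
    (hVℓ : (ℓ • (1 : Matrix ι ι ℝ) - V).PosSemidef) {N : ℕ} {S : Set (Matrix ι ι ℝ)} {w : ℝ}
    {F D : Fin N → Matrix ι ι ℝ} (hB : IsBracketing S V w F D) (p o : ι → ℝ)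
    {κ γ θ δ : ℝ} (hκ : 0 < κ) (hγ : 0 < γ) (hθ : 0 < θ) (hδ : 0 < δ) :
    ∃ Ψ : Ω → ℝ, Integrable Ψ P ∧
      ∫ ω, Ψ ω ∂P ≤
        ((1 + N) * ((2 * s ^ 2 + m) * (ℓ ^ 2 * Fintype.card ι)) + N * (s * (ℓ ^ 2 * (p ⬝ᵥ p)))) / κ
        + N * (s * (ℓ ^ 2 * (o ⬝ᵥ o))) / γ
        + N * ((2 * s ^ 2 + m) * (ℓ ^ 4 * Fintype.card ι)) / (δ * θ) ∧
      ∀ ω, ∀ R ∈ S, ∀ μ : ℝ, ∀ u, u = z ω + p - μ • o →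
        |2 * (z ω ⬝ᵥ ((V * R) *ᵥ u) - s * (V * R).trace) - (z ω ⬝ᵥ (V *ᵥ z ω) - s * V.trace)| ≤
          Ψ ω + 3 * κ + γ * μ ^ 2 + θ * (u ⬝ᵥ u) + (s * (ℓ * w) + δ) / θ + 2 * (s * w) := by
  have hVt := transpose_eq_of_posSemidef hV
  -- Squared deviations at the finitely many brackets: pure noise, noise at an upper bracket, its
  -- linear terms in `p` and `o`, and the form of the bracket width in `V z`. Their sums over `j`
  -- replace a maximum over the grid.
  set T0 : Ω → ℝ := fun ω => (z ω ⬝ᵥ (V *ᵥ z ω) - s * V.trace) ^ 2 with hT0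
  set T1 : Fin N → Ω → ℝ := fun j ω =>
    (z ω ⬝ᵥ ((V * F j) *ᵥ z ω) - s * (V * F j).trace) ^ 2 with hT1
  set T2 : Fin N → Ω → ℝ := fun j ω => (z ω ⬝ᵥ ((V * F j) *ᵥ p)) ^ 2 with hT2
  set T3 : Fin N → Ω → ℝ := fun j ω => (z ω ⬝ᵥ ((V * F j) *ᵥ o)) ^ 2 with hT3
  set T4 : Fin N → Ω → ℝ := fun j ω =>
    (z ω ⬝ᵥ ((V * D j * V) *ᵥ z ω) - s * (V * D j * V).trace) ^ 2 with hT4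
  have i0 : Integrable T0 P := hz.integrable_quadForm_sub_sq _ _
  have i1 : ∀ j, Integrable (T1 j) P := fun j => hz.integrable_quadForm_sub_sq _ _
  have i2 : ∀ j, Integrable (T2 j) P := fun j => hz.integrable_dotProduct_sq _
  have i3 : ∀ j, Integrable (T3 j) P := fun j => hz.integrable_dotProduct_sq _
  have i4 : ∀ j, Integrable (T4 j) P := fun j => hz.integrable_quadForm_sub_sq _ _
  have hc4 : 0 ≤ 2 * s ^ 2 + m := by positivity
  have e0 : ∫ ω, T0 ω ∂P ≤ (2 * s ^ 2 + m) * (ℓ ^ 2 * Fintype.card ι) := by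
    refine (hz.integral_quadForm_sub_sq_le hm V).trans (mul_le_mul_of_nonneg_left ?_ hc4)
    rw [hVt]
    exact trace_le_smul_card (sq_smul_one_sub_sq_posSemidef hℓ hV hVℓ)
  have e1 : ∀ j, ∫ ω, T1 j ω ∂P ≤ (2 * s ^ 2 + m) * (ℓ ^ 2 * Fintype.card ι) := fun j =>
    (hz.integral_quadForm_sub_sq_le hm _).trans (mul_le_mul_of_nonneg_left
      (trace_mul_transpose_le hℓ hV hVℓ (hB.posSemidef_upper j) (hB.one_sub_upper j)) hc4)
  have elin : ∀ (j : Fin N) (v : ι → ℝ),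
      ∫ ω, (z ω ⬝ᵥ ((V * F j) *ᵥ v)) ^ 2 ∂P ≤ s * (ℓ ^ 2 * (v ⬝ᵥ v)) := by
    intro j v
    rw [hz.integral_dotProduct_sq]
    refine mul_le_mul_of_nonneg_left ?_ hs
    rw [← Matrix.mulVec_mulVec]
    refine (dotProduct_mulVec_self_le hℓ hV hVℓ _).trans
      (mul_le_mul_of_nonneg_left ?_ (sq_nonneg _))
    have := dotProduct_mulVec_self_le zero_le_one (hB.posSemidef_upper j)
      (by simpa using hB.one_sub_upper j) v
    simpa using this
  have e4 : ∀ j, ∫ ω, T4 j ω ∂P ≤ (2 * s ^ 2 + m) * (ℓ ^ 4 * Fintype.card ι) := fun j =>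
    (hz.integral_quadForm_sub_sq_le hm _).trans (mul_le_mul_of_nonneg_left
      (trace_conj_mul_transpose_le hℓ hV hVℓ (hB.posSemidef_width j) (hB.one_sub_width j)) hc4)
  have isum : ∀ T : Fin N → Ω → ℝ, (∀ j, Integrable (T j) P) →
      Integrable (fun ω => ∑ j, T j ω) P := fun T h => integrable_finsetSum _ fun j _ => h j
  have esum : ∀ (T : Fin N → Ω → ℝ) (C : ℝ), (∀ j, Integrable (T j) P) →
      (∀ j, ∫ ω, T j ω ∂P ≤ C) → ∫ ω, ∑ j, T j ω ∂P ≤ N * C := by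
    intro T C hi h
    rw [integral_finsetSum _ fun j _ => hi j]
    refine (Finset.sum_le_sum fun j _ => h j).trans ?_
    simp
  have j01 : Integrable (fun ω => T0 ω + ∑ j, T1 j ω) P := i0.add (isum T1 i1)
  have j012 : Integrable (fun ω => T0 ω + ∑ j, T1 j ω + ∑ j, T2 j ω) P := j01.add (isum T2 i2)
  have k3 : Integrable (fun ω => (∑ j, T3 j ω) / γ) P := (isum T3 i3).div_const _
  have k4 : Integrable (fun ω => (∑ j, T4 j ω) / (δ * θ)) P := (isum T4 i4).div_const _
  have k0 : Integrable (fun ω => (T0 ω + ∑ j, T1 j ω + ∑ j, T2 j ω) / κ) P := j012.div_const _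
  have k03 : Integrable (fun ω => (T0 ω + ∑ j, T1 j ω + ∑ j, T2 j ω) / κ + (∑ j, T3 j ω) / γ) P :=
    k0.add k3
  refine ⟨fun ω => (T0 ω + ∑ j, T1 j ω + ∑ j, T2 j ω) / κ + (∑ j, T3 j ω) / γ +
    (∑ j, T4 j ω) / (δ * θ), ?_, ?_, ?_⟩
  · exact k03.add k4
  · rw [integral_add k03 k4, integral_add k0 k3, integral_div, integral_div, integral_div,
      integral_add j01 (isum T2 i2), integral_add i0 (isum T1 i1)]
    have f1 := esum T1 _ i1 e1
    have f2 := esum T2 _ i2 fun j => elin j p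
    have f3 := esum T3 _ i3 fun j => elin j o
    have f4 := esum T4 _ i4 e4
    gcongr
    linarith
  · intro ω R hR μ u hu
    obtain ⟨j, hj0, hj1⟩ := hB.exists_mem R hR
    set E := F j - R with hE
    have hRE : R = F j - E := by rw [hE]; abel
    have hVR : V * R = V * F j - V * E := by rw [hRE, Matrix.mul_sub]
    have hu' : z ω ⬝ᵥ ((V * F j) *ᵥ u) = z ω ⬝ᵥ ((V * F j) *ᵥ z ω) + z ω ⬝ᵥ ((V * F j) *ᵥ p)
        - μ * (z ω ⬝ᵥ ((V * F j) *ᵥ o)) := by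
      rw [hu, Matrix.mulVec_sub, Matrix.mulVec_add, Matrix.mulVec_smul, dotProduct_sub,
        dotProduct_add, dotProduct_smul, smul_eq_mul]
    have hVE : z ω ⬝ᵥ ((V * E) *ᵥ u) = (V *ᵥ z ω) ⬝ᵥ (E *ᵥ u) := by
      rw [← Matrix.mulVec_mulVec, Matrix.dotProduct_mulVec, ← Matrix.mulVec_transpose, hVt]
    have hVDV : (V *ᵥ z ω) ⬝ᵥ (D j *ᵥ (V *ᵥ z ω)) = z ω ⬝ᵥ ((V * D j * V) *ᵥ z ω) := by
      rw [Matrix.mul_assoc, ← Matrix.mulVec_mulVec, Matrix.dotProduct_mulVec (z ω),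
        ← Matrix.mulVec_transpose V, hVt, Matrix.mulVec_mulVec]
    have hEu : u ⬝ᵥ (E *ᵥ u) ≤ u ⬝ᵥ u := by
      have a1 := quadForm_le hj1 u
      have a2 := quadForm_le (hB.one_sub_width j) u
      rw [Matrix.one_mulVec] at a2
      exact a1.trans a2
    -- The remainder depends on the data through `R`, so no moment of it is available.
    -- Cauchy-Schwarz in its own form splits off `u`, and on `V z` it is dominated by the nonrandom
    -- width `D j`.
    have hb := two_mul_abs_dotProduct_mulVec_le hj0 hθ (V *ᵥ z ω) u
    have hq := quadForm_le hj1 (V *ᵥ z ω)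
    rw [hVDV] at hq
    have htr : (V * D j * V).trace ≤ ℓ * w := by
      have a1 : ((V * V) * D j).trace ≤ (ℓ • V * D j).trace := by
        have := trace_mul_nonneg (smul_self_sub_sq_posSemidef hℓ hV hVℓ) (hB.posSemidef_width j)
        rw [Matrix.sub_mul, Matrix.trace_sub] at this
        linarith
      rw [Matrix.trace_mul_cycle]
      refine a1.trans ?_
      rw [Matrix.smul_mul, Matrix.trace_smul, smul_eq_mul]
      exact mul_le_mul_of_nonneg_left (hB.trace_width j) hℓ
    have hE0 : 0 ≤ (V * E).trace := trace_mul_nonneg hV hj0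
    have hE1 : (V * E).trace ≤ w := (trace_mul_le hV hj1).trans (hB.trace_width j)
    have single : ∀ T : Fin N → Ω → ℝ, (∀ j, 0 ≤ T j ω) → T j ω ≤ ∑ j, T j ω := fun T h =>
      Finset.single_le_sum (f := fun j => T j ω) (fun j _ => h j) (Finset.mem_univ j)
    have s1 := single T1 fun j => sq_nonneg _
    have s2 := single T2 fun j => sq_nonneg _
    have s3 := single T3 fun j => sq_nonneg _
    have s4 := single T4 fun j => sq_nonneg _
    have b0 := two_mul_abs_le hκ (z ω ⬝ᵥ (V *ᵥ z ω) - s * V.trace)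
    have b1 := two_mul_abs_le hκ (z ω ⬝ᵥ ((V * F j) *ᵥ z ω) - s * (V * F j).trace)
    have b2 := two_mul_abs_le hκ (z ω ⬝ᵥ ((V * F j) *ᵥ p))
    have b4 := two_mul_abs_le hδ (z ω ⬝ᵥ ((V * D j * V) *ᵥ z ω) - s * (V * D j * V).trace)
    -- The location is data-dependent, so it is separated from the noise by a weighted square; `γ`
    -- is later matched to the bound on `μ ^ 2`.
    have b3 : 2 * |μ * (z ω ⬝ᵥ ((V * F j) *ᵥ o))| ≤ γ * μ ^ 2 + T3 j ω / γ := by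
      have hpos : 0 ≤ (γ * |μ| - |z ω ⬝ᵥ ((V * F j) *ᵥ o)|) ^ 2 / γ := by positivity
      have : (γ * |μ| - |z ω ⬝ᵥ ((V * F j) *ᵥ o)|) ^ 2 / γ = γ * μ ^ 2 + T3 j ω / γ -
          2 * |μ * (z ω ⬝ᵥ ((V * F j) *ᵥ o))| := by
        rw [abs_mul, hT3, sub_sq, mul_pow, sq_abs, sq_abs]
        field_simp
        ring
      linarith
    change 2 * |_| ≤ κ + T0 ω / κ at b0
    change 2 * |_| ≤ κ + T1 j ω / κ at b1
    change 2 * |_| ≤ κ + T2 j ω / κ at b2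
    change 2 * |_| ≤ δ + T4 j ω / δ at b4
    have c0 : 0 ≤ T0 ω / κ := div_nonneg (sq_nonneg _) hκ.le
    have c1 : T1 j ω / κ ≤ (∑ j, T1 j ω) / κ := by gcongr
    have c2 : T2 j ω / κ ≤ (∑ j, T2 j ω) / κ := by gcongr
    have c3 : T3 j ω / γ ≤ (∑ j, T3 j ω) / γ := by gcongr
    have c4 : T4 j ω / (δ * θ) ≤ (∑ j, T4 j ω) / (δ * θ) := by gcongr
    have hq' : (V *ᵥ z ω) ⬝ᵥ (E *ᵥ (V *ᵥ z ω)) / θ ≤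
        (s * (ℓ * w) + δ) / θ + T4 j ω / (δ * θ) := by
      rw [← div_div, ← add_div]
      have g1 : s * (V * D j * V).trace ≤ s * (ℓ * w) := mul_le_mul_of_nonneg_left htr hs
      have g2 := le_abs_self (z ω ⬝ᵥ ((V * D j * V) *ᵥ z ω) - s * (V * D j * V).trace)
      have g3 := abs_nonneg (z ω ⬝ᵥ ((V * D j * V) *ᵥ z ω) - s * (V * D j * V).trace)
      gcongr
      linarith
    have hθu : θ * (u ⬝ᵥ (E *ᵥ u)) ≤ θ * (u ⬝ᵥ u) := mul_le_mul_of_nonneg_left hEu hθ.le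
    have hsE : |s * (V * E).trace| ≤ s * w := by
      rw [abs_of_nonneg (mul_nonneg hs hE0)]
      exact mul_le_mul_of_nonneg_left hE1 hs
    have key : 2 * (z ω ⬝ᵥ ((V * R) *ᵥ u) - s * (V * R).trace) -
        (z ω ⬝ᵥ (V *ᵥ z ω) - s * V.trace) =
        2 * (z ω ⬝ᵥ ((V * F j) *ᵥ z ω) - s * (V * F j).trace) + 2 * (z ω ⬝ᵥ ((V * F j) *ᵥ p))
        - 2 * (μ * (z ω ⬝ᵥ ((V * F j) *ᵥ o))) - 2 * ((V *ᵥ z ω) ⬝ᵥ (E *ᵥ u))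
        + 2 * (s * (V * E).trace) - (z ω ⬝ᵥ (V *ᵥ z ω) - s * V.trace) := by
      rw [hVR, Matrix.sub_mulVec, dotProduct_sub, Matrix.trace_sub, hu', hVE]
      ring
    beta_reduce
    rw [key, add_div (T0 ω + ∑ j, T1 j ω), add_div (T0 ω), abs_le]
    have n0 := abs_nonneg (z ω ⬝ᵥ (V *ᵥ z ω) - s * V.trace)
    have a0 := abs_le.1 (le_refl |z ω ⬝ᵥ (V *ᵥ z ω) - s * V.trace|)
    have a1 := abs_le.1 (le_refl |z ω ⬝ᵥ ((V * F j) *ᵥ z ω) - s * (V * F j).trace|)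
    have a2 := abs_le.1 (le_refl |z ω ⬝ᵥ ((V * F j) *ᵥ p)|)
    have a3 := abs_le.1 (le_refl |μ * (z ω ⬝ᵥ ((V * F j) *ᵥ o))|)
    have a4 := abs_le.1 (le_refl |(V *ᵥ z ω) ⬝ᵥ (E *ᵥ u)|)
    have a5 := abs_le.1 hsE
    constructor
    · linarith only [n0, a0.1, a0.2, a1.1, a1.2, a2.1, a2.2, a3.1, a3.2, a4.1, a4.2, a5.1, a5.2, b0,
        b1, b2, b3, b4, c0, c1, c2, c3, c4, hq', hθu, hb]
    · linarith only [n0, a0.1, a0.2, a1.1, a1.2, a2.1, a2.2, a3.1, a3.2, a4.1, a4.2, a5.1, a5.2, b0,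
        b1, b2, b3, b4, c0, c1, c2, c3, c4, hq', hθu, hb]

end UniformBound

end CrossClassified

namespace CrossClassified

/-! ### Whitening the Gaussian data. -/

section DataLaw

variable {r c : ℕ} (k : Fin r → Fin c → ℕ)

theorem whiteNoise_apply (η : Fin r × Fin c → ℝ) (y : Obs k → ℝ) (e : Obs k) :
    whiteNoise k η y e = √(k e.1.1 e.1.2 : ℝ) * (y e - η e.1) := by
  rw [whiteNoise, noiseRootInv, Matrix.mulVec_diagonal, Pi.sub_apply]

instance (σ : ℝ) (η : Fin r × Fin c → ℝ) : IsProbabilityMeasure (dataLaw k σ η) := by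
  unfold dataLaw; infer_instance

theorem gaussianReal_map_whiten (σ : ℝ) (a : ℝ) {K : ℝ} (hK : 0 < K) :
    (gaussianReal a (Real.toNNReal (σ ^ 2 / K))).map (fun x => √K * (x - a)) =
      gaussianReal 0 (Real.toNNReal (σ ^ 2)) := by
  have h1 : (fun x => √K * (x - a)) = (fun x => √K * x) ∘ fun x => x - a := rfl
  rw [h1, ← Measure.map_map (by fun_prop) (by fun_prop), gaussianReal_map_sub_const,
    gaussianReal_map_const_mul, sub_self, mul_zero]
  congr 1
  ext
  rw [NNReal.coe_mul, Real.coe_toNNReal _ (by positivity), Real.coe_toNNReal _ (by positivity)]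
  change √K ^ 2 * _ = _
  rw [Real.sq_sqrt hK.le]
  field_simp

/-- Whitening gives every cell the same centred Gaussian law, so one fourth moment, depending only
on `σ`, serves all tables. -/
theorem isNoise_whiteNoise (σ : ℝ) (η : Fin r × Fin c → ℝ) :
    IsNoise (dataLaw k σ η) (whiteNoise k η) (σ ^ 2)
      (∫ x, x ^ 4 ∂(gaussianReal 0 (Real.toNNReal (σ ^ 2)))) := by
  have hz : whiteNoise k η = fun y e =>
      (fun (e : Obs k) x => √(k e.1.1 e.1.2 : ℝ) * (x - η e.1)) e (y e) := by
    ext y e; exact whiteNoise_apply k η y e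
  have hmap := fun e : Obs k => gaussianReal_map_whiten σ (η e.1) (count_pos k e)
  have hpow : ∀ j : ℕ, Integrable (fun x : ℝ => x ^ j)
      (gaussianReal 0 (Real.toNNReal (σ ^ 2))) := by
    intro j
    have := (memLp_id_gaussianReal (μ := 0) (v := Real.toNNReal (σ ^ 2)) j).integrable_norm_pow'
    refine this.mono' (by fun_prop) (Eventually.of_forall fun x => ?_)
    simp
  have hint : ∀ (e : Obs k) (j : ℕ),
      ∫ x, (√(k e.1.1 e.1.2 : ℝ) * (x - η e.1)) ^ j
        ∂(gaussianReal (η e.1) (Real.toNNReal (σ ^ 2 / k e.1.1 e.1.2))) =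
      ∫ x, x ^ j ∂(gaussianReal 0 (Real.toNNReal (σ ^ 2))) := by
    intro e j
    rw [← hmap e, integral_map (by fun_prop) (by fun_prop)]
  rw [hz, dataLaw]
  refine isNoise_pi _ _ _ _ (fun e j => ?_) (fun e => ?_) (fun e => ?_) fun e => hint e 4
  · have := hpow j
    rw [← hmap e, integrable_map_measure (by fun_prop) (by fun_prop)] at this
    exact this
  · have := hint e 1
    simp only [pow_one] at this
    rw [this, integral_id_gaussianReal]
  · rw [hint e 2]
    have h := variance_fun_id_gaussianReal (μ := 0) (v := Real.toNNReal (σ ^ 2))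
    rw [variance_of_integral_eq_zero (by fun_prop) (by simp)] at h
    rw [h, Real.coe_toNNReal _ (sq_nonneg _)]

theorem integrable_whiteNoise_sq (σ : ℝ) (η : Fin r × Fin c → ℝ) :
    Integrable (fun y => whiteNoise k η y ⬝ᵥ whiteNoise k η y) (dataLaw k σ η) := by
  simpa using (isNoise_whiteNoise k σ η).integrable_quadForm 1

theorem integral_whiteNoise_sq (σ : ℝ) (η : Fin r × Fin c → ℝ) :
    ∫ y, whiteNoise k η y ⬝ᵥ whiteNoise k η y ∂(dataLaw k σ η) =
      σ ^ 2 * Fintype.card (Obs k) := by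
  simpa using (isNoise_whiteNoise k σ η).integral_quadForm 1

end DataLaw

/-! ### Control of the location by the quantile constraint. -/

section Quantile

variable {r c : ℕ} {k : Fin r → Fin c → ℕ}

theorem card_mul_sq_le {y : Obs k → ℝ} {x : ℝ} {p : Obs k → Prop} (h : ∀ e, p e → x ^ 2 ≤ y e ^ 2) :
    (Nat.card {e // p e} : ℝ) * x ^ 2 ≤ y ⬝ᵥ y := by
  classical
  rw [Nat.card_eq_fintype_card, Fintype.card_subtype, ← nsmul_eq_mul, ← Finset.sum_const, dotProduct]
  calc ∑ _e with p _e, x ^ 2 ≤ ∑ e with p e, y e * y e :=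
        Finset.sum_le_sum fun e he => by
          rw [← pow_two]; exact h e (Finset.mem_filter.1 he).2
    _ ≤ ∑ e, y e * y e :=
        Finset.sum_le_sum_of_subset_of_nonneg (Finset.filter_subset _ _)
          fun e _ _ => mul_self_nonneg _

theorem le_sum_abs (y : Obs k → ℝ) (e : Obs k) : |y e| ≤ ∑ e, |y e| :=
  Finset.single_le_sum (f := fun e => |y e|) (fun _ _ => abs_nonneg _) (Finset.mem_univ e)

/-- Together with nonemptiness this makes `sInf` a genuine infimum and not its default value `0`. -/
theorem bddBelow_quantile_set [Nonempty (Obs k)] {p : ℝ} (hp : 0 < p) (y : Obs k → ℝ) :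
    BddBelow {x : ℝ | p * Nat.card (Obs k) ≤ Nat.card {e : Obs k // y e ≤ x}} := by
  refine ⟨-∑ e, |y e|, fun x hx => ?_⟩
  by_contra! hlt
  have : IsEmpty {e : Obs k // y e ≤ x} := ⟨fun e => by
    have h1 := le_sum_abs y e.1
    have h2 := neg_abs_le (y e.1)
    linarith [e.2]⟩
  have hn : (0 : ℝ) < Nat.card (Obs k) := by exact_mod_cast Nat.card_pos
  have hx' : p * Nat.card (Obs k) ≤ Nat.card {e : Obs k // y e ≤ x} := hx
  rw [Nat.card_of_isEmpty (α := {e : Obs k // y e ≤ x}), Nat.cast_zero] at hx'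
  nlinarith

theorem nonempty_quantile_set {p : ℝ} (hp : p ≤ 1) (y : Obs k → ℝ) :
    {x : ℝ | p * Nat.card (Obs k) ≤ Nat.card {e : Obs k // y e ≤ x}}.Nonempty := by
  refine ⟨∑ e, |y e|, ?_⟩
  have h : Nat.card {e : Obs k // y e ≤ ∑ e, |y e|} = Nat.card (Obs k) :=
    Nat.card_congr (Equiv.subtypeUnivEquiv fun e => (le_abs_self _).trans (le_sum_abs y e))
  rw [Set.mem_ofPred_eq, h]
  exact mul_le_of_le_one_left (Nat.cast_nonneg _) hp

/-- If `0 < x < |μ|`, then at least a fraction `τ/2` of the observations have absolute value at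
least `x`, on the side of the sign of `μ`. Hence `(τ/2) n x² ≤ ‖y‖²`, and `x` tends to `|μ|`. -/
theorem card_mul_sq_le_of_mem_hyperRange [Nonempty (Obs k)] {τ : ℝ} (hτ : 0 < τ) (hτ' : τ ≤ 1)
    {y : Obs k → ℝ} {t : ℝ × ℝ≥0∞ × ℝ≥0∞} (ht : t ∈ hyperRange k τ y) :
    Fintype.card (Obs k) * t.1 ^ 2 ≤ 2 / τ * (y ⬝ᵥ y) := by
  have hn : (0 : ℝ) < Nat.card (Obs k) := by exact_mod_cast Nat.card_pos
  set S := 2 / τ * (y ⬝ᵥ y) / Nat.card (Obs k) with hS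
  have hS0 : 0 ≤ S := by have := dotProduct_self_nonneg_real y; positivity
  have key : ∀ x : ℝ, τ / 2 * Nat.card (Obs k) * x ^ 2 ≤ y ⬝ᵥ y → |x| ≤ √S := by
    intro x hx
    refine Real.abs_le_sqrt ?_
    rw [hS, le_div_iff₀ hn, div_mul_eq_mul_div, le_div_iff₀ hτ]
    linarith
  have habs : |t.1| ≤ √S := by
    rcases le_or_gt 0 t.1 with h0 | h0
    · rw [abs_of_nonneg h0]
      refine le_of_forall_lt_imp_le_of_dense fun x hx => ?_
      rcases le_or_gt x 0 with hx0 | hx0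
      · exact hx0.trans (Real.sqrt_nonneg _)
      refine (le_abs_self x).trans (key x ?_)
      have hnot := notMem_of_lt_csInf (hx.trans_le ht.2)
        (bddBelow_quantile_set (show 0 < 1 - τ / 2 by linarith) y)
      rw [Set.mem_ofPred_eq, not_le] at hnot
      have hsum : (Nat.card {e : Obs k // y e ≤ x} : ℝ) + Nat.card {e : Obs k // ¬ y e ≤ x} =
          Nat.card (Obs k) := by
        classical
        rw [Nat.card_eq_fintype_card, Nat.card_eq_fintype_card, Nat.card_eq_fintype_card,
          ← Nat.cast_add, Fintype.card_subtype_compl, Nat.add_sub_cancel' (Fintype.card_subtype_le _)]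
      refine le_trans ?_ (card_mul_sq_le (x := x) (p := fun e => ¬ y e ≤ x) fun e he => ?_)
      · refine mul_le_mul_of_nonneg_right ?_ (sq_nonneg _)
        linarith
      · exact pow_le_pow_left₀ hx0.le (not_le.1 he).le 2
    · rw [abs_of_neg h0]
      refine le_of_forall_lt_imp_le_of_dense fun x hx => ?_
      rcases le_or_gt x 0 with hx0 | hx0
      · exact hx0.trans (Real.sqrt_nonneg _)
      rw [← abs_of_pos hx0, ← abs_neg]
      refine key (-x) ?_
      obtain ⟨x', hx', hlt⟩ := exists_lt_of_csInf_lt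
        (nonempty_quantile_set (show τ / 2 ≤ 1 by linarith) y)
        (ht.1.trans_lt (show t.1 < -x by linarith))
      have hx'' : τ / 2 * Nat.card (Obs k) ≤ Nat.card {e : Obs k // y e ≤ x'} := hx'
      refine le_trans (mul_le_mul_of_nonneg_right hx'' (sq_nonneg _))
        (card_mul_sq_le (x := -x) (p := fun e => y e ≤ x') fun e he => ?_)
      nlinarith
  have h2 : t.1 ^ 2 ≤ S := by
    rw [← sq_abs, ← Real.sq_sqrt hS0]
    exact pow_le_pow_left₀ (abs_nonneg _) habs 2
  rw [hS, le_div_iff₀ hn, Nat.card_eq_fintype_card] at h2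
  linarith

end Quantile

end CrossClassified

namespace CrossClassified

/-! ### Bounds in terms of the cell counts, and the rate. -/

section CountBounds

variable {r c : ℕ} (k : Fin r → Fin c → ℕ)

/-- The largest count of an observed cell. -/
noncomputable def maxCount : ℝ := ⨆ e : Obs k, (k e.1.1 e.1.2 : ℝ)

/-- The smallest count of an observed cell. -/
noncomputable def minCount : ℝ := ⨅ e : Obs k, (k e.1.1 e.1.2 : ℝ)

variable {k}

theorem count_le_maxCount (e : Obs k) : (k e.1.1 e.1.2 : ℝ) ≤ maxCount k :=
  le_ciSup (f := fun e : Obs k => (k e.1.1 e.1.2 : ℝ)) (Set.finite_range _).bddAbove e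

theorem minCount_le_count (e : Obs k) : minCount k ≤ k e.1.1 e.1.2 :=
  ciInf_le (f := fun e : Obs k => (k e.1.1 e.1.2 : ℝ)) (Set.finite_range _).bddBelow e

theorem one_le_minCount [Nonempty (Obs k)] : 1 ≤ minCount k :=
  le_ciInf fun e => by exact_mod_cast e.2

theorem minCount_le_maxCount [Nonempty (Obs k)] : minCount k ≤ maxCount k :=
  (minCount_le_count (Classical.arbitrary _)).trans (count_le_maxCount _)

theorem dotProduct_noiseRootInv_le (v : Obs k → ℝ) :
    (noiseRootInv k *ᵥ v) ⬝ᵥ (noiseRootInv k *ᵥ v) ≤ maxCount k * (v ⬝ᵥ v) := by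
  simp only [dotProduct, Finset.mul_sum]
  refine Finset.sum_le_sum fun e _ => ?_
  rw [noiseRootInv, Matrix.mulVec_diagonal]
  have h := Real.mul_self_sqrt (count_pos k e).le
  calc √(k e.1.1 e.1.2 : ℝ) * v e * (√(k e.1.1 e.1.2 : ℝ) * v e) =
      (√(k e.1.1 e.1.2 : ℝ) * √(k e.1.1 e.1.2 : ℝ)) * (v e * v e) := by ring
    _ ≤ _ := by
      rw [h]; exact mul_le_mul_of_nonneg_right (count_le_maxCount e) (mul_self_nonneg _)

theorem dotProduct_noiseRoot_le [Nonempty (Obs k)] (v : Obs k → ℝ) :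
    (noiseRoot k *ᵥ v) ⬝ᵥ (noiseRoot k *ᵥ v) ≤ (minCount k)⁻¹ * (v ⬝ᵥ v) := by
  simp only [dotProduct, Finset.mul_sum]
  refine Finset.sum_le_sum fun e _ => ?_
  rw [noiseRoot, Matrix.mulVec_diagonal]
  have h := Real.mul_self_sqrt (count_pos k e).le
  calc (√(k e.1.1 e.1.2 : ℝ))⁻¹ * v e * ((√(k e.1.1 e.1.2 : ℝ))⁻¹ * v e) =
      (√(k e.1.1 e.1.2 : ℝ) * √(k e.1.1 e.1.2 : ℝ))⁻¹ * (v e * v e) := by rw [mul_inv]; ring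
    _ ≤ _ := by
      rw [h]
      refine mul_le_mul_of_nonneg_right ?_ (mul_self_nonneg _)
      exact inv_anti₀ (zero_lt_one.trans_le one_le_minCount) (minCount_le_count e)

/-- The bound `Q ≤ λ₁(Q)` is conjugated by `M^(1/2)`, whose square is at most `1 / min K`. -/
theorem whiteLoss_le [Nonempty (Obs k)] :
    ((maxEigenvalue (lossMatrix k) / minCount k) • (1 : Matrix (Obs k) (Obs k) ℝ) -
      whiteLoss k).PosSemidef := by
  refine posSemidef_sub_of_quadForm_le (transpose_eq_of_posSemidef (whiteLoss_posSemidef k))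
    (by simp) fun x => ?_
  have h1 : x ⬝ᵥ (whiteLoss k *ᵥ x) =
      (noiseRoot k *ᵥ x) ⬝ᵥ (lossMatrix k *ᵥ (noiseRoot k *ᵥ x)) := by
    rw [whiteLoss, Matrix.mul_assoc, ← Matrix.mulVec_mulVec, Matrix.dotProduct_mulVec x,
      ← Matrix.mulVec_transpose (noiseRoot k), noiseRoot_transpose, Matrix.mulVec_mulVec]
  rw [h1, quadForm_smul_one]
  have h2 := quadForm_le (maxEigenvalue_smul_one_sub_posSemidef (lossMatrix_posSemidef k))
    (noiseRoot k *ᵥ x)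
  rw [quadForm_smul_one] at h2
  refine h2.trans ?_
  rw [div_eq_mul_inv, mul_assoc]
  exact mul_le_mul_of_nonneg_left (dotProduct_noiseRoot_le x)
    (maxEigenvalue_nonneg (lossMatrix_posSemidef k))

theorem dotProduct_add_self_le {n : Type*} [Fintype n] (a b : n → ℝ) :
    (a + b) ⬝ᵥ (a + b) ≤ 2 * (a ⬝ᵥ a) + 2 * (b ⬝ᵥ b) := by
  simp only [dotProduct, Finset.mul_sum, ← Finset.sum_add_distrib, Pi.add_apply]
  exact Finset.sum_le_sum fun e _ => by nlinarith [sq_nonneg (a e - b e)]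

theorem dotProduct_sub_self_le {n : Type*} [Fintype n] (a b : n → ℝ) :
    (a - b) ⬝ᵥ (a - b) ≤ 2 * (a ⬝ᵥ a) + 2 * (b ⬝ᵥ b) := by
  have := dotProduct_add_self_le a (-b)
  rwa [neg_dotProduct_neg, ← sub_eq_add_neg] at this

theorem dotProduct_data_le [Nonempty (Obs k)] (η : Fin r × Fin c → ℝ) (y : Obs k → ℝ) :
    y ⬝ᵥ y ≤ 2 * ((fun e : Obs k => η e.1) ⬝ᵥ fun e => η e.1) +
      2 * (whiteNoise k η y ⬝ᵥ whiteNoise k η y) := by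
  have h1 := dotProduct_add_self_le (fun e : Obs k => η e.1) (noiseRoot k *ᵥ whiteNoise k η y)
  have h2 := dotProduct_noiseRoot_le (whiteNoise k η y)
  have h3 : (minCount k)⁻¹ ≤ 1 := inv_le_one_of_one_le₀ one_le_minCount
  have h4 : (fun e : Obs k => η e.1) + noiseRoot k *ᵥ whiteNoise k η y = y := by
    rw [noiseRoot_mulVec_whiteNoise]; abel
  rw [h4] at h1
  nlinarith [dotProduct_self_nonneg_real (whiteNoise k η y)]

theorem dotProduct_obs_le (η : Fin r × Fin c → ℝ) :
    ((fun e : Obs k => η e.1) ⬝ᵥ fun e => η e.1) ≤ ∑ q, η q ^ 2 := by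
  simp only [dotProduct, ← pow_two]
  have := Finset.sum_le_univ_sum_of_nonneg (s := Finset.univ.map
    (Function.Embedding.subtype fun q : Fin r × Fin c => 0 < k q.1 q.2))
    (f := fun q => η q ^ 2) fun q => sq_nonneg _
  rwa [Finset.sum_map] at this

theorem dotProduct_whiteResid_le [Nonempty (Obs k)] {τ : ℝ} (hτ : 0 < τ) (hτ' : τ ≤ 1)
    {y : Obs k → ℝ} {t : ℝ × ℝ≥0∞ × ℝ≥0∞} (ht : t ∈ hyperRange k τ y) :
    whiteResid k t.1 y ⬝ᵥ whiteResid k t.1 y ≤ maxCount k * (2 * (1 + 2 / τ)) * (y ⬝ᵥ y) := by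
  have hmax : 0 ≤ maxCount k :=
    (zero_le_one.trans one_le_minCount).trans minCount_le_maxCount
  refine (dotProduct_noiseRootInv_le _).trans ?_
  rw [mul_assoc]
  refine mul_le_mul_of_nonneg_left ?_ hmax
  have h1 := dotProduct_sub_self_le y fun _ => t.1
  have h2 := card_mul_sq_le_of_mem_hyperRange hτ hτ' ht
  have h3 : ((fun _ => t.1 : Obs k → ℝ) ⬝ᵥ fun _ => t.1) = Fintype.card (Obs k) * t.1 ^ 2 := by
    simp [dotProduct, pow_two]
  rw [h3] at h1
  linarith

theorem nonempty_obs_of_isEstimable (hk : IsEstimable k) (hr : 0 < r) (hc : 0 < c) :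
    Nonempty (Obs k) := by
  by_contra h
  rw [not_nonempty_iff] at h
  obtain ⟨B, hB⟩ := hk
  have := congrFun (congrFun hB (⟨0, hr⟩, ⟨0, hc⟩)) (Sum.inl ⟨0, hr⟩)
  simp [Matrix.mul_apply, fullDesign] at this

theorem card_obs_le : (Fintype.card (Obs k) : ℝ) ≤ r * c := by
  have h : Fintype.card (Obs k) ≤ Fintype.card (Fin r × Fin c) := Fintype.card_subtype_le _
  rw [Fintype.card_prod, Fintype.card_fin, Fintype.card_fin] at h
  exact_mod_cast h

end CountBounds

/-- With `h = (rc)^(1/8)`, every contribution is at most a constant times `Λ h⁷`, so division by `rc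
= h⁸` leaves `Λ / h`. The exponent seven is the geometric mean of the bracket width `h⁶` and the
squared residual `h⁸`, as Cauchy-Schwarz produces it. -/
theorem rate_bound {σ τ C c₄ : ℝ} (hτ : 0 < τ) (hC : 0 ≤ C) (hc₄ : 0 ≤ c₄) {h n N ℓ kM Λ p o w Y : ℝ}
    (hh : 1 ≤ h) (hn : 0 < n) (hnX : n ≤ h ^ 8) (hN : N ≤ 2 * h ^ 2) (hℓ : 0 ≤ ℓ)
    (hkM : 0 < kM) (hΛ : 1 ≤ Λ) (hℓΛ : ℓ ≤ Λ) (hℓk : ℓ ^ 2 * kM ≤ Λ ^ 2)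
    (hp0 : 0 ≤ p) (hp : p ≤ kM * (C * h ^ 8)) (ho0 : 0 ≤ o) (ho : o ≤ kM * n) (hw : w ≤ 2 * ℓ * h ^ 6)
    (hY : Y ≤ 2 * (C + σ ^ 2) * h ^ 8) :
    ((1 + N) * (c₄ * (ℓ ^ 2 * n)) + N * (σ ^ 2 * (ℓ ^ 2 * p))) / (Λ * h ^ 7)
      + N * (σ ^ 2 * (ℓ ^ 2 * o)) / (n * Λ / h)
      + N * (c₄ * (ℓ ^ 4 * n)) / ((Λ ^ 2 * h ^ 6 / kM) * (Λ / (h * kM)))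
      + 3 * (Λ * h ^ 7) + Λ / h * (2 / τ) * Y + Λ / (h * kM) * (kM * (2 * (1 + 2 / τ))) * Y
      + (σ ^ 2 * (ℓ * w) + Λ ^ 2 * h ^ 6 / kM) / (Λ / (h * kM)) + 2 * (σ ^ 2 * w)
    ≤ (5 * c₄ + 2 * σ ^ 2 * C + 8 * σ ^ 2 + 4 + (4 / τ) * (C + σ ^ 2)
        + 4 * (1 + 2 / τ) * (C + σ ^ 2)) * (Λ * h ^ 7) := by
  have hh0 : 0 < h := by linarith
  have hΛ0 : 0 < Λ := by linarith
  have hσ : 0 ≤ σ ^ 2 := sq_nonneg σ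
  have hmono : ∀ {i j : ℕ}, i ≤ j → h ^ i ≤ h ^ j := fun hij => pow_le_pow_right₀ hh hij
  have hN1 : 1 + N ≤ 3 * h ^ 2 := by nlinarith [hmono (i := 0) (j := 2) (by norm_num)]
  have hℓ2 : ℓ ^ 2 ≤ Λ ^ 2 := pow_le_pow_left₀ hℓ hℓΛ 2
  have hp' : ℓ ^ 2 * p ≤ Λ ^ 2 * (C * h ^ 8) := by
    calc ℓ ^ 2 * p ≤ ℓ ^ 2 * (kM * (C * h ^ 8)) := by gcongr
      _ = (ℓ ^ 2 * kM) * (C * h ^ 8) := by ring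
      _ ≤ _ := by gcongr
  have ho' : ℓ ^ 2 * o ≤ Λ ^ 2 * n := by
    calc ℓ ^ 2 * o ≤ ℓ ^ 2 * (kM * n) := by gcongr
      _ = (ℓ ^ 2 * kM) * n := by ring
      _ ≤ _ := by gcongr
  have hA : ((1 + N) * (c₄ * (ℓ ^ 2 * n)) + N * (σ ^ 2 * (ℓ ^ 2 * p))) / (Λ * h ^ 7) ≤
      (3 * c₄ + 2 * σ ^ 2 * C) * (Λ * h ^ 7) := by
    rw [div_le_iff₀ (by positivity)]
    calc _ ≤ 3 * h ^ 2 * (c₄ * (Λ ^ 2 * h ^ 8)) + 2 * h ^ 2 * (σ ^ 2 * (Λ ^ 2 * (C * h ^ 8))) := by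
          gcongr
      _ = (3 * c₄ + 2 * σ ^ 2 * C) * (Λ ^ 2 * h ^ 10) := by ring
      _ ≤ (3 * c₄ + 2 * σ ^ 2 * C) * (Λ ^ 2 * h ^ 14) := by
          gcongr ?_ * (_ * ?_)
          exact hmono (by norm_num)
      _ = _ := by ring
  have hB : N * (σ ^ 2 * (ℓ ^ 2 * o)) / (n * Λ / h) ≤ 2 * σ ^ 2 * (Λ * h ^ 7) := by
    rw [div_le_iff₀ (by positivity)]
    calc _ ≤ 2 * h ^ 2 * (σ ^ 2 * (Λ ^ 2 * n)) := by gcongr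
      _ = 2 * σ ^ 2 * (Λ ^ 2 * n) * h ^ 2 := by ring
      _ ≤ 2 * σ ^ 2 * (Λ ^ 2 * n) * h ^ 6 := by gcongr ?_ * ?_; exact hmono (by norm_num)
      _ = _ := by field_simp
  have hD : N * (c₄ * (ℓ ^ 4 * n)) / ((Λ ^ 2 * h ^ 6 / kM) * (Λ / (h * kM))) ≤
      2 * c₄ * (Λ * h ^ 7) := by
    rw [div_le_iff₀ (by positivity)]
    have h4 : ℓ ^ 4 * kM ^ 2 ≤ Λ ^ 4 := by
      calc ℓ ^ 4 * kM ^ 2 = (ℓ ^ 2 * kM) ^ 2 := by ring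
        _ ≤ (Λ ^ 2) ^ 2 := pow_le_pow_left₀ (by positivity) hℓk 2
        _ = _ := by ring
    have h5 : ℓ ^ 4 ≤ Λ ^ 4 / kM ^ 2 := by rwa [le_div_iff₀ (by positivity)]
    calc _ ≤ 2 * h ^ 2 * (c₄ * (Λ ^ 4 / kM ^ 2 * h ^ 8)) := by gcongr
      _ = 2 * c₄ * (Λ ^ 4 / kM ^ 2) * h ^ 10 := by ring
      _ ≤ 2 * c₄ * (Λ ^ 4 / kM ^ 2) * h ^ 12 := by gcongr ?_ * ?_; exact hmono (by norm_num)
      _ = _ := by field_simp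
  have hE : Λ / h * (2 / τ) * Y ≤ (4 / τ) * (C + σ ^ 2) * (Λ * h ^ 7) := by
    calc _ ≤ Λ / h * (2 / τ) * (2 * (C + σ ^ 2) * h ^ 8) := by gcongr
      _ = _ := by field_simp; ring
  have hF : Λ / (h * kM) * (kM * (2 * (1 + 2 / τ))) * Y ≤
      4 * (1 + 2 / τ) * (C + σ ^ 2) * (Λ * h ^ 7) := by
    calc _ ≤ Λ / (h * kM) * (kM * (2 * (1 + 2 / τ))) * (2 * (C + σ ^ 2) * h ^ 8) := by gcongr
      _ = _ := by field_simp; ring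
  have hG : (σ ^ 2 * (ℓ * w) + Λ ^ 2 * h ^ 6 / kM) / (Λ / (h * kM)) ≤
      (2 * σ ^ 2 + 1) * (Λ * h ^ 7) := by
    rw [div_le_iff₀ (by positivity)]
    have h5 : ℓ ^ 2 ≤ Λ ^ 2 / kM := by rwa [le_div_iff₀ hkM]
    have h6 : ℓ * w ≤ Λ ^ 2 / kM * (2 * h ^ 6) := by
      calc ℓ * w ≤ ℓ * (2 * ℓ * h ^ 6) := by gcongr
        _ = ℓ ^ 2 * (2 * h ^ 6) := by ring
        _ ≤ _ := by gcongr
    calc _ ≤ σ ^ 2 * (Λ ^ 2 / kM * (2 * h ^ 6)) + Λ ^ 2 * h ^ 6 / kM := by gcongr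
      _ = _ := by field_simp
  have hH : 2 * (σ ^ 2 * w) ≤ 4 * σ ^ 2 * (Λ * h ^ 7) := by
    calc 2 * (σ ^ 2 * w) ≤ 2 * (σ ^ 2 * (2 * Λ * h ^ 7)) := by
          gcongr
          refine hw.trans ?_
          gcongr ?_ * ?_
          · linarith
          · exact hmono (by norm_num)
      _ = _ := by ring
  linarith

end CrossClassified

namespace CrossClassified

/-! ### Uniform closeness of risk estimate and loss. -/

section UniformURE

set_option maxHeartbeats 3000000 in
/-- The risk estimate is uniformly close to the loss over the hyper-parameter range. -/
theorem exists_uniform_ure_bound {σ τ C : ℝ} (hτ : 0 < τ) (hτ' : τ ≤ 1) (hC : 0 ≤ C) :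
    ∃ A : ℝ, ∀ (r c : ℕ) (k : Fin r → Fin c → ℕ) (η : Fin r × Fin c → ℝ), 0 < r → 0 < c →
      Nonempty (Obs k) → cellMap k *ᵥ (fun e => η e.1) = η →
      ((r : ℝ) * c)⁻¹ * ∑ q, η q ^ 2 ≤ C →
      ∃ D : (Obs k → ℝ) → ℝ, Integrable D (dataLaw k σ η) ∧
        ∫ y, D y ∂(dataLaw k σ η) ≤
          A * (((r : ℝ) * c) ^ (-(1 / 8) : ℝ) *
            (countRatio k * maxEigenvalue (lossMatrix k) + 1)) ∧
        ∀ y, ∀ t ∈ hyperRange k τ y, |ure k σ t y - loss η (cellEst k t y)| ≤ D y := by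
  set m₄ : ℝ := ∫ x, x ^ 4 ∂(gaussianReal 0 (Real.toNNReal (σ ^ 2))) with hm₄
  have hm₄0 : 0 ≤ m₄ := integral_nonneg fun x => by positivity
  set c₄ : ℝ := 2 * (σ ^ 2) ^ 2 + m₄ with hc₄
  have hc₄0 : 0 ≤ c₄ := by positivity
  refine ⟨5 * c₄ + 2 * σ ^ 2 * C + 8 * σ ^ 2 + 4 + (4 / τ) * (C + σ ^ 2)
        + 4 * (1 + 2 / τ) * (C + σ ^ 2), fun r c k η hr hc hne hη hηC => ?_⟩
  set A : ℝ := 5 * c₄ + 2 * σ ^ 2 * C + 8 * σ ^ 2 + 4 + (4 / τ) * (C + σ ^ 2)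
        + 4 * (1 + 2 / τ) * (C + σ ^ 2)
  set X : ℝ := (r : ℝ) * c with hX
  have hr1 : (1 : ℝ) ≤ r := by exact_mod_cast hr
  have hc1 : (1 : ℝ) ≤ c := by exact_mod_cast hc
  have hX1 : 1 ≤ X := one_le_mul_of_one_le_of_one_le hr1 hc1
  have hX0 : 0 < X := by linarith
  set h : ℝ := X ^ (1 / 8 : ℝ) with hh
  have hh1 : 1 ≤ h := Real.one_le_rpow hX1 (by norm_num)
  have hh0 : 0 < h := by linarith
  have hh8 : h ^ 8 = X := by
    rw [hh, ← Real.rpow_natCast, ← Real.rpow_mul hX0.le]; norm_num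
  have hhinv : X ^ (-(1 / 8) : ℝ) = h⁻¹ := Real.rpow_neg hX0.le _
  set n : ℝ := (Fintype.card (Obs k) : ℝ) with hn
  have hn0 : 0 < n := by rw [hn]; exact_mod_cast Fintype.card_pos
  have hnX : n ≤ h ^ 8 := by rw [hh8]; exact card_obs_le
  set lam := maxEigenvalue (lossMatrix k) with hlam
  have hlam0 : 0 ≤ lam := maxEigenvalue_nonneg (lossMatrix_posSemidef k)
  set kM := maxCount k with hkM
  set km := minCount k with hkm
  have hkm1 : 1 ≤ km := one_le_minCount
  have hkmM : km ≤ kM := minCount_le_maxCount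
  have hkM0 : 0 < kM := by linarith
  have hkm0 : 0 < km := by linarith
  have hratio : countRatio k = kM / km := rfl
  set ν := countRatio k
  have hν1 : 1 ≤ ν := by rw [hratio]; exact (one_le_div hkm0).2 hkmM
  set ℓ := lam / km with hℓ
  have hℓ0 : 0 ≤ ℓ := by positivity
  -- The summand `1` keeps the weights below positive when `lam = 0`; it adds only a term of order
  -- `(rc)^(-1/8)`.
  set Λ := ν * lam + 1 with hΛ
  have hΛ1 : 1 ≤ Λ := by rw [hΛ]; nlinarith [mul_nonneg (zero_le_one.trans hν1) hlam0]
  have hΛ0 : 0 < Λ := by linarith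
  have hlΛ : ν * lam ≤ Λ := by rw [hΛ]; linarith
  have hℓΛ : ℓ ≤ Λ := by
    have : ℓ ≤ lam := div_le_self hlam0 hkm1
    nlinarith
  -- Whitening inflates squared means by `kM`, while `ℓ` carries `1 / km`; since `km ≥ 1` and `ν ≥
  -- 1`, only the ratio of the counts survives.
  have hℓk : ℓ ^ 2 * kM ≤ Λ ^ 2 := by
    have e1 : ℓ ^ 2 * kM = lam ^ 2 * ν / km := by rw [hratio, hℓ]; field_simp
    have e2 : lam ^ 2 * ν / km ≤ lam ^ 2 * ν := div_le_self (by positivity) hkm1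
    have e3 : lam ^ 2 * ν ≤ (ν * lam) ^ 2 := by
      rw [mul_pow, mul_comm]
      refine mul_le_mul_of_nonneg_right ?_ (sq_nonneg _)
      nlinarith
    rw [e1]
    exact (e2.trans e3).trans (pow_le_pow_left₀ (by positivity) hlΛ 2)
  -- This grid brings `tr V / N` down to `ℓ h⁶`; the rank term is smaller, at most `ℓ √(rc) = ℓ h⁴`.
  set N : ℕ := ⌈h ^ 2⌉₊ with hN
  have hNpos : 0 < N := Nat.ceil_pos.2 (by positivity)
  have hNlow : h ^ 2 ≤ N := Nat.le_ceil _
  have hNup : (N : ℝ) ≤ 2 * h ^ 2 := by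
    have := (Nat.ceil_lt_add_one (sq_nonneg h)).le
    nlinarith
  have hN0 : (0 : ℝ) < N := by exact_mod_cast hNpos
  set V := whiteLoss k with hV
  have hVpsd : V.PosSemidef := whiteLoss_posSemidef k
  have hVℓ : (ℓ • (1 : Matrix (Obs k) (Obs k) ℝ) - V).PosSemidef := whiteLoss_le
  obtain ⟨F, D, hB⟩ := exists_isBracketing_min_rank (rowCov_posSemidef k) (colCov_posSemidef k)
    hVpsd hℓ0 hVℓ hNpos
  set w := V.trace / N + ℓ * (min (rowCov k).rank (colCov k).rank : ℕ) with hw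
  have hw6 : w ≤ 2 * ℓ * h ^ 6 := by
    have e1 : V.trace / N ≤ ℓ * h ^ 6 := by
      rw [div_le_iff₀ hN0]
      calc V.trace ≤ ℓ * n := trace_le_smul_card hVℓ
        _ ≤ ℓ * h ^ 8 := by gcongr
        _ = ℓ * h ^ 6 * h ^ 2 := by ring
        _ ≤ _ := by gcongr
    have e2 : ((min (rowCov k).rank (colCov k).rank : ℕ) : ℝ) ≤ h ^ 4 := by
      have a1 : ((min (rowCov k).rank (colCov k).rank : ℕ) : ℝ) ≤ r := by
        exact_mod_cast (min_le_left _ _).trans (rank_rowCov_le k)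
      have a2 : ((min (rowCov k).rank (colCov k).rank : ℕ) : ℝ) ≤ c := by
        exact_mod_cast (min_le_right _ _).trans (rank_colCov_le k)
      refine le_of_sq_le_sq ?_ (by positivity)
      calc _ = ((min (rowCov k).rank (colCov k).rank : ℕ) : ℝ) *
            (min (rowCov k).rank (colCov k).rank : ℕ) := pow_two _
        _ ≤ r * c := by gcongr
        _ = _ := by rw [← hX, ← hh8]; ring
    have e3 : h ^ 4 ≤ h ^ 6 := pow_le_pow_right₀ hh1 (by norm_num)
    have e4 : ℓ * ((min (rowCov k).rank (colCov k).rank : ℕ) : ℝ) ≤ ℓ * h ^ 6 :=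
      mul_le_mul_of_nonneg_left (e2.trans e3) hℓ0
    rw [hw]; linarith
  set p : Obs k → ℝ := noiseRootInv k *ᵥ fun e => η e.1 with hp
  set o : Obs k → ℝ := noiseRootInv k *ᵥ fun _ => 1 with ho
  have hηX : ∑ q, η q ^ 2 ≤ C * h ^ 8 := by
    rw [hh8]
    rwa [inv_mul_le_iff₀ hX0, mul_comm] at hηC
  have hηobs : ((fun e : Obs k => η e.1) ⬝ᵥ fun e => η e.1) ≤ C * h ^ 8 :=
    (dotProduct_obs_le η).trans hηX
  have hpp : p ⬝ᵥ p ≤ kM * (C * h ^ 8) :=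
    (dotProduct_noiseRootInv_le _).trans (mul_le_mul_of_nonneg_left hηobs hkM0.le)
  have hoo : o ⬝ᵥ o ≤ kM * n := by
    refine (dotProduct_noiseRootInv_le _).trans (le_of_eq ?_)
    simp [dotProduct, hn, hkM]
  -- `γ` and `θ` are scaled so that `γ μ²` and `θ ‖u‖²` have mean of order `Λ h⁷`; `δ` makes `δ / θ`
  -- exactly `Λ h⁷`.
  set κ := Λ * h ^ 7
  set γ := n * Λ / h with hγ
  set θ := Λ / (h * kM) with hθ
  set δ := Λ ^ 2 * h ^ 6 / kM
  obtain ⟨Ψ, hΨi, hΨ, hbound⟩ := exists_uniform_bound (isNoise_whiteNoise k σ η) (sq_nonneg σ)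
    hm₄0 hℓ0 hVpsd hVℓ hB p o (show 0 < κ by positivity) (show 0 < γ by positivity)
    (show 0 < θ by positivity) (show 0 < δ by positivity)
  set Y : (Obs k → ℝ) → ℝ := fun y => 2 * ((fun e : Obs k => η e.1) ⬝ᵥ fun e => η e.1) +
      2 * (whiteNoise k η y ⬝ᵥ whiteNoise k η y) with hYdef
  have hYi : Integrable Y (dataLaw k σ η) :=
    (integrable_const _).add ((integrable_whiteNoise_sq k σ η).const_mul 2)
  have hYE : ∫ y, Y y ∂(dataLaw k σ η) ≤ 2 * (C + σ ^ 2) * h ^ 8 := by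
    rw [hYdef, integral_add (integrable_const _) ((integrable_whiteNoise_sq k σ η).const_mul 2),
      integral_const, integral_const_mul, integral_whiteNoise_sq, probReal_univ, one_smul]
    have : σ ^ 2 * n ≤ σ ^ 2 * h ^ 8 := mul_le_mul_of_nonneg_left hnX (sq_nonneg _)
    linarith
  set a := Λ / h * (2 / τ) + θ * (kM * (2 * (1 + 2 / τ))) with ha
  set b := 3 * κ + (σ ^ 2 * (ℓ * w) + δ) / θ + 2 * (σ ^ 2 * w) with hb
  have haYi : Integrable (fun y => a * Y y) (dataLaw k σ η) := hYi.const_mul a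
  have hsum : Integrable (fun y => Ψ y + a * Y y) (dataLaw k σ η) := hΨi.add haYi
  refine ⟨fun y => X⁻¹ * (Ψ y + a * Y y + b), (hsum.add (integrable_const b)).const_mul _, ?_, ?_⟩
  · rw [integral_const_mul, integral_add hsum (integrable_const b), integral_add hΨi haYi,
      integral_const_mul, integral_const, probReal_univ, one_smul]
    have hfin := rate_bound (σ := σ) hτ hC hc₄0 hh1 hn0 hnX hNup hℓ0 hkM0 hΛ1 hℓΛ hℓk
      (dotProduct_self_nonneg_real p) hpp (dotProduct_self_nonneg_real o) hoo hw6 hYE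
    have hle : ∫ y, Ψ y ∂(dataLaw k σ η) + a * ∫ y, Y y ∂(dataLaw k σ η) + b ≤ A * (Λ * h ^ 7) := by
      have hΨ' : ∫ y, Ψ y ∂(dataLaw k σ η) ≤
          ((1 + N) * (c₄ * (ℓ ^ 2 * n)) + N * (σ ^ 2 * (ℓ ^ 2 * (p ⬝ᵥ p)))) / (Λ * h ^ 7)
          + N * (σ ^ 2 * (ℓ ^ 2 * (o ⬝ᵥ o))) / (n * Λ / h)
          + N * (c₄ * (ℓ ^ 4 * n)) / ((Λ ^ 2 * h ^ 6 / kM) * (Λ / (h * kM))) := hΨ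
      have hb' : b = 3 * (Λ * h ^ 7) + (σ ^ 2 * (ℓ * w) + Λ ^ 2 * h ^ 6 / kM) / (Λ / (h * kM))
          + 2 * (σ ^ 2 * w) := hb
      refine le_trans ?_ hfin
      rw [ha, hb', hθ]
      linarith only [hΨ']
    calc X⁻¹ * _ ≤ X⁻¹ * (A * (Λ * h ^ 7)) :=
          mul_le_mul_of_nonneg_left hle (inv_nonneg.2 hX0.le)
      _ = A * (X ^ (-(1 / 8) : ℝ) * Λ) := by
          rw [hhinv, ← hh8]; field_simp
  · intro y t ht
    have hyY : y ⬝ᵥ y ≤ Y y := dotProduct_data_le η y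
    have hu : whiteResid k t.1 y = whiteNoise k η y + p - t.1 • o := by
      rw [whiteResid, whiteNoise, hp, ho, ← Matrix.mulVec_add, ← Matrix.mulVec_smul,
        ← Matrix.mulVec_sub]
      congr 1
      ext e
      simp
    have h1 := hbound y (whitePrecision k t.2) ⟨t.2, rfl⟩ t.1 _ hu
    rw [ure_sub_loss_eq σ hη, abs_mul, abs_of_pos (inv_pos.2 hX0)]
    refine mul_le_mul_of_nonneg_left (h1.trans ?_) (inv_nonneg.2 hX0.le)
    have h2 : γ * t.1 ^ 2 ≤ Λ / h * (2 / τ) * Y y := by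
      calc γ * t.1 ^ 2 = Λ / h * (n * t.1 ^ 2) := by rw [hγ]; ring
        _ ≤ Λ / h * (2 / τ * Y y) := by
          refine mul_le_mul_of_nonneg_left ?_ (by positivity)
          exact (card_mul_sq_le_of_mem_hyperRange hτ hτ' ht).trans
            (mul_le_mul_of_nonneg_left hyY (by positivity))
        _ = _ := by ring
    have h3 : θ * (whiteResid k t.1 y ⬝ᵥ whiteResid k t.1 y) ≤
        θ * (kM * (2 * (1 + 2 / τ))) * Y y := by
      rw [mul_assoc]
      refine mul_le_mul_of_nonneg_left ?_ (by positivity)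
      exact (dotProduct_whiteResid_le hτ hτ' ht).trans
        (mul_le_mul_of_nonneg_left hyY (by positivity))
    rw [ha, hb]
    linarith

end UniformURE

/-! ### Measurability and integrability of the losses. -/

section Integrability

variable {r c : ℕ} {k : Fin r → Fin c → ℕ}

theorem measurable_whitePrecision_apply {t : (Obs k → ℝ) → ℝ × ℝ≥0∞ × ℝ≥0∞} (ht : Measurable t)
    (e f : Obs k) : Measurable fun y => whitePrecision k (t y).2 e f := by
  have h1 : Continuous fun l => whitePrecision k l e f :=
    (continuous_limitResolvent (rowCov_posSemidef k) (colCov_posSemidef k)).matrix_elem e f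
  exact h1.measurable.comp ht.snd

theorem measurable_loss_cellEst {η : Fin r × Fin c → ℝ}
    {t : (Obs k → ℝ) → ℝ × ℝ≥0∞ × ℝ≥0∞} (ht : Measurable t) :
    Measurable fun y => loss η (cellEst k (t y) y) := by
  have hP : ∀ e f, Measurable fun y => precision k (t y).2 e f := by
    intro e f
    simp only [precision_eq, noiseRootInv, Matrix.diagonal_mul, Matrix.mul_diagonal]
    exact ((measurable_whitePrecision_apply ht e f).const_mul _).mul_const _
  have hS : ∀ e, Measurable fun y => shrinkEst k (t y) y e := by
    intro e
    simp only [shrinkEst, noiseCov, Pi.sub_apply, Matrix.mulVec, dotProduct, Matrix.diagonal_mul]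
    refine (measurable_pi_apply e).sub (Finset.measurable_sum _ fun f _ => ?_)
    exact ((hP e f).const_mul _).mul ((measurable_pi_apply f).sub ht.fst)
  unfold loss cellEst
  simp only [Matrix.mulVec, dotProduct]
  refine (Finset.measurable_sum _ fun p _ => ?_).const_mul _
  exact ((Finset.measurable_sum _ fun e _ => (hS e).const_mul _).sub_const _).pow_const 2

/-- As `R` is a contraction and `V ≤ ℓ`, the loss is dominated by a quadratic in the noise, whatever
the hyper-parameter estimates. -/
theorem integrable_loss_cellEst {σ τ : ℝ} (hτ : 0 < τ) (hτ' : τ ≤ 1) {η : Fin r × Fin c → ℝ}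
    (hr : 0 < r) (hc : 0 < c) (hne : Nonempty (Obs k)) (hη : cellMap k *ᵥ (fun e => η e.1) = η)
    {t : (Obs k → ℝ) → ℝ × ℝ≥0∞ × ℝ≥0∞} (ht : IsHyperEst k τ t) :
    Integrable (fun y => loss η (cellEst k (t y) y)) (dataLaw k σ η) := by
  set ℓ := maxEigenvalue (lossMatrix k) / minCount k with hℓ
  have hℓ0 : 0 ≤ ℓ := div_nonneg (maxEigenvalue_nonneg (lossMatrix_posSemidef k))
    (zero_le_one.trans one_le_minCount)
  have hmax : 0 ≤ maxCount k := (zero_le_one.trans one_le_minCount).trans minCount_le_maxCount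
  have hX : (0 : ℝ) ≤ ((r : ℝ) * c)⁻¹ := by positivity
  set Y : (Obs k → ℝ) → ℝ := fun y => 2 * ((fun e : Obs k => η e.1) ⬝ᵥ fun e => η e.1) +
      2 * (whiteNoise k η y ⬝ᵥ whiteNoise k η y) with hYdef
  have hYi : Integrable Y (dataLaw k σ η) :=
    (integrable_const _).add ((integrable_whiteNoise_sq k σ η).const_mul 2)
  have hdom : Integrable (fun y => ((r : ℝ) * c)⁻¹ * (ℓ * (2 * (whiteNoise k η y ⬝ᵥ whiteNoise k η y)
      + 2 * (maxCount k * (2 * (1 + 2 / τ)) * Y y)))) (dataLaw k σ η) :=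
    ((((integrable_whiteNoise_sq k σ η).const_mul 2).add
      ((hYi.const_mul _).const_mul 2)).const_mul ℓ).const_mul _
  refine hdom.mono' (measurable_loss_cellEst ht.measurable).aestronglyMeasurable
    (Eventually.of_forall fun y => ?_)
  have hloss0 : 0 ≤ loss η (cellEst k (t y) y) :=
    mul_nonneg hX (Finset.sum_nonneg fun _ _ => sq_nonneg _)
  rw [Real.norm_of_nonneg hloss0, loss_cellEst_eq hη]
  refine mul_le_mul_of_nonneg_left ?_ hX
  have h1 := quadForm_le whiteLoss_le
    (whiteNoise k η y - whitePrecision k (t y).2 *ᵥ whiteResid k (t y).1 y)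
  rw [quadForm_smul_one] at h1
  refine h1.trans (mul_le_mul_of_nonneg_left ?_ hℓ0)
  refine (dotProduct_sub_self_le _ _).trans ?_
  have hP : ((1 : ℝ) • (1 : Matrix (Obs k) (Obs k) ℝ) - whitePrecision k (t y).2).PosSemidef := by
    rw [one_smul]
    exact one_sub_limitResolvent_posSemidef (rowCov_posSemidef k) (colCov_posSemidef k) _
  have h2 := dotProduct_mulVec_self_le zero_le_one
    (limitResolvent_posSemidef (rowCov_posSemidef k) (colCov_posSemidef k) _) hP
    (whiteResid k (t y).1 y)
  rw [one_pow, one_mul] at h2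
  have h3 := dotProduct_whiteResid_le hτ hτ' (ht.mem_range y)
  have h4 : maxCount k * (2 * (1 + 2 / τ)) * (y ⬝ᵥ y) ≤ maxCount k * (2 * (1 + 2 / τ)) * Y y :=
    mul_le_mul_of_nonneg_left (dotProduct_data_le η y) (by positivity)
  have h5 := (h2.trans h3).trans h4
  exact add_le_add le_rfl (mul_le_mul_of_nonneg_left h5 zero_le_two)

end Integrability

end CrossClassified

namespace CrossClassified

/-! ### From uniform closeness to comparison of losses. -/

section Comparison

theorem integrable_loss_of_isHyperEst {σ τ : ℝ} (hτ : 0 < τ) (hτ' : τ ≤ 1) {r c : ℕ}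
    {k : Fin r → Fin c → ℕ} (hk : IsEstimable k) (m : ℝ) (α : Fin r → ℝ) (β : Fin c → ℝ)
    {t : (Obs k → ℝ) → ℝ × ℝ≥0∞ × ℝ≥0∞} (ht : IsHyperEst k τ t) :
    Integrable (fun y => loss (cellMeans m α β) (cellEst k (t y) y))
      (dataLaw k σ (cellMeans m α β)) := by
  rcases Nat.eq_zero_or_pos r with hr | hr
  -- For an empty table the normalization is `0⁻¹ = 0`, so the loss vanishes.
  · simp [loss, hr]
  rcases Nat.eq_zero_or_pos c with hc | hc
  · simp [loss, hc]
  exact integrable_loss_cellEst hτ hτ' hr hc (nonempty_obs_of_isEstimable hk hr hc)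
    (cellMap_mulVec_cellMeans hk m α β) ht

theorem tendsto_fst_mul_snd_atTop :
    Tendsto (fun p : ℕ × ℕ => (p.1 : ℝ) * p.2) atTop atTop := by
  rw [← prod_atTop_atTop_eq]
  exact (tendsto_natCast_atTop_atTop.comp tendsto_fst).atTop_mul_atTop₀
    (tendsto_natCast_atTop_atTop.comp tendsto_snd)

/-- The squared logarithm is eventually at least `1` and can be discarded; the added `1` costs
`(rc)^(-1/8)`, which vanishes by itself. -/
theorem tendsto_rate {f : ℕ × ℕ → ℝ} (hf : ∀ p, 0 ≤ f p)
    (h : Tendsto (fun p : ℕ × ℕ => ((p.1 : ℝ) * p.2) ^ (-(1 / 8) : ℝ) *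
      Real.log ((p.1 : ℝ) * p.2) ^ 2 * f p) atTop (𝓝 0)) :
    Tendsto (fun p : ℕ × ℕ => ((p.1 : ℝ) * p.2) ^ (-(1 / 8) : ℝ) * (f p + 1)) atTop (𝓝 0) := by
  have h1 : Tendsto (fun p : ℕ × ℕ => ((p.1 : ℝ) * p.2) ^ (-(1 / 8) : ℝ)) atTop (𝓝 0) :=
    (tendsto_rpow_neg_atTop (by norm_num)).comp tendsto_fst_mul_snd_atTop
  have hlog : ∀ᶠ p : ℕ × ℕ in atTop, 1 ≤ Real.log ((p.1 : ℝ) * p.2) :=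
    (Real.tendsto_log_atTop.comp tendsto_fst_mul_snd_atTop).eventually_ge_atTop 1
  have hpos : ∀ p : ℕ × ℕ, 0 ≤ ((p.1 : ℝ) * p.2) ^ (-(1 / 8) : ℝ) := fun p =>
    Real.rpow_nonneg (by positivity) _
  have h2 : Tendsto (fun p : ℕ × ℕ => ((p.1 : ℝ) * p.2) ^ (-(1 / 8) : ℝ) * f p) atTop (𝓝 0) := by
    refine squeeze_zero' (Eventually.of_forall fun p => mul_nonneg (hpos p) (hf p)) ?_ h
    filter_upwards [hlog] with p hp
    refine mul_le_mul_of_nonneg_right ?_ (hf p)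
    exact le_mul_of_one_le_right (hpos p) (one_le_pow₀ hp)
  simpa [mul_add] using h2.add h1

/-- Comparison of the losses of a minimizer of a risk estimate and of a competitor, when the risk
estimate is within `D` of the loss. -/
theorem integral_le_of_abs_sub_le {Ω : Type*} [MeasurableSpace Ω] {P : Measure Ω}
    {LU L UU U D : Ω → ℝ} (hLU : Integrable LU P) (hL : Integrable L P) (hD : Integrable D P)
    (hU : ∀ y, UU y ≤ U y) (h1 : ∀ y, |UU y - LU y| ≤ D y) (h2 : ∀ y, |U y - L y| ≤ D y) :
    (∫ y, LU y ∂P ≤ ∫ y, L y ∂P + 2 * ∫ y, D y ∂P) ∧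
    ∀ ε : ℝ, 0 < ε → P {y | L y + ε ≤ LU y} ≤ ENNReal.ofReal (2 / ε * ∫ y, D y ∂P) := by
  have hpt : ∀ y, LU y ≤ L y + 2 * D y := fun y => by
    have a1 := (abs_le.1 (h1 y)).1
    have a2 := (abs_le.1 (h2 y)).2
    linarith [hU y]
  -- The envelope is nonnegative because it dominates an absolute value; Markov's inequality then
  -- applies at level `ε / 2`.
  have hD0 : ∀ y, 0 ≤ D y := fun y => (abs_nonneg _).trans (h1 y)
  constructor
  · rw [← integral_const_mul, ← integral_add hL (hD.const_mul 2)]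
    exact integral_mono hLU (hL.add (hD.const_mul 2)) hpt
  · intro ε hε
    have hM := mul_meas_ge_le_lintegral₀ (μ := P) (f := fun y => ENNReal.ofReal (D y))
      hD.aemeasurable.ennreal_ofReal (ENNReal.ofReal (ε / 2))
    rw [← ofReal_integral_eq_lintegral_ofReal hD (Eventually.of_forall hD0)] at hM
    have hsub : {y | L y + ε ≤ LU y} ⊆ {y | ENNReal.ofReal (ε / 2) ≤ ENNReal.ofReal (D y)} := by
      intro y hy
      have hy' : L y + ε ≤ LU y := hy
      exact ENNReal.ofReal_le_ofReal (by linarith [hpt y])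
    refine (measure_mono hsub).trans ?_
    have hε2 : 0 < ε / 2 := by linarith
    rw [show 2 / ε * ∫ y, D y ∂P = (∫ y, D y ∂P) / (ε / 2) by field_simp,
      ENNReal.ofReal_div_of_pos hε2]
    exact (ENNReal.le_div_iff_mul_le (Or.inl (by simpa using hε2)) (Or.inl ENNReal.ofReal_ne_top)).2
      (by rwa [mul_comm])

end Comparison

end CrossClassified

theorem mainTheorem4
    (σ : ℝ) (hσ : 0 < σ) (τ : ℝ) (hτ : 0 < τ) (hτ' : τ ≤ 1)
    (K : ∀ r c : ℕ, Fin r → Fin c → ℕ)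
    (hK : ∀ r c : ℕ, CrossClassified.IsEstimable (K r c))
    (m : ℕ → ℕ → ℝ) (α : ∀ r _c : ℕ, Fin r → ℝ) (β : ∀ _r c : ℕ, Fin c → ℝ)
    (hA1 : ∃ C : ℝ, ∀ᶠ p : ℕ × ℕ in atTop,
      ((p.1 : ℝ) * p.2)⁻¹ *
        ∑ q, CrossClassified.cellMeans (m p.1 p.2) (α p.1 p.2) (β p.1 p.2) q ^ 2 ≤ C)
    (hA2 : Tendsto (fun p : ℕ × ℕ =>
        ((p.1 : ℝ) * p.2) ^ (-(1 / 8) : ℝ) * Real.log ((p.1 : ℝ) * p.2) ^ 2 *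
          CrossClassified.countRatio (K p.1 p.2) *
          CrossClassified.maxEigenvalue (CrossClassified.lossMatrix (K p.1 p.2)))
      atTop (𝓝 0))
    (tU : ∀ r c : ℕ, (CrossClassified.Obs (K r c) → ℝ) → ℝ × ℝ≥0∞ × ℝ≥0∞)
    (htU : ∀ r c : ℕ, CrossClassified.IsUREHyperEst (K r c) σ τ (tU r c))
    (t : ∀ r c : ℕ, (CrossClassified.Obs (K r c) → ℝ) → ℝ × ℝ≥0∞ × ℝ≥0∞)
    (ht : ∀ r c : ℕ, CrossClassified.IsHyperEst (K r c) τ (t r c)) :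
    let η : ∀ r c : ℕ, Fin r × Fin c → ℝ := fun r c =>
      CrossClassified.cellMeans (m r c) (α r c) (β r c)
    let P : ∀ r c : ℕ, Measure (CrossClassified.Obs (K r c) → ℝ) := fun r c =>
      CrossClassified.dataLaw (K r c) σ (η r c)
    let LU : ∀ r c : ℕ, (CrossClassified.Obs (K r c) → ℝ) → ℝ := fun r c y =>
      CrossClassified.loss (η r c) (CrossClassified.cellEst (K r c) (tU r c y) y)
    let L : ∀ r c : ℕ, (CrossClassified.Obs (K r c) → ℝ) → ℝ := fun r c y =>
      CrossClassified.loss (η r c) (CrossClassified.cellEst (K r c) (t r c y) y)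
    (∀ ε : ℝ, 0 < ε →
      Tendsto (fun p : ℕ × ℕ => P p.1 p.2 {y | L p.1 p.2 y + ε ≤ LU p.1 p.2 y}) atTop (𝓝 0)) ∧
    ((∀ r c : ℕ, Integrable (LU r c) (P r c) ∧ Integrable (L r c) (P r c)) ∧
      ∀ ε : ℝ, 0 < ε → ∀ᶠ p : ℕ × ℕ in atTop,
        ∫ y, LU p.1 p.2 y ∂(P p.1 p.2) ≤ ∫ y, L p.1 p.2 y ∂(P p.1 p.2) + ε) := by
  open CrossClassified in
  intro η P LU L
  have hint : ∀ (r c : ℕ) (s : (Obs (K r c) → ℝ) → ℝ × ℝ≥0∞ × ℝ≥0∞), IsHyperEst (K r c) τ s →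
      Integrable (fun y => loss (η r c) (cellEst (K r c) (s y) y)) (P r c) := fun r c s hs =>
    integrable_loss_of_isHyperEst hτ hτ' (hK r c) (m r c) (α r c) (β r c) hs
  have hLU : ∀ r c, Integrable (LU r c) (P r c) := fun r c => hint r c _ (htU r c).toIsHyperEst
  have hL : ∀ r c, Integrable (L r c) (P r c) := fun r c => hint r c _ (ht r c)
  obtain ⟨C, hC⟩ := hA1
  -- The bound from (A1) is replaced by `max C 0`, as the uniform estimate requires a nonnegative
  -- constant; `A` is then the same for all tables.
  obtain ⟨A, hA⟩ := exists_uniform_ure_bound (σ := σ) hτ hτ' (le_max_right C 0)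
  have hrate := tendsto_rate (f := fun p => countRatio (K p.1 p.2) *
    maxEigenvalue (lossMatrix (K p.1 p.2)))
    (fun p => mul_nonneg (div_nonneg (Real.iSup_nonneg fun _ => Nat.cast_nonneg _)
      (Real.iInf_nonneg fun _ => Nat.cast_nonneg _))
      (maxEigenvalue_nonneg (lossMatrix_posSemidef _)))
    (by simpa only [mul_assoc] using hA2)
  set B : ℕ × ℕ → ℝ := fun p => A * (((p.1 : ℝ) * p.2) ^ (-(1 / 8) : ℝ) *
    (countRatio (K p.1 p.2) * maxEigenvalue (lossMatrix (K p.1 p.2)) + 1)) with hB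
  have hB0 : Tendsto B atTop (𝓝 0) := by
    have := hrate.const_mul A
    rwa [mul_zero] at this
  have hmain : ∀ᶠ p : ℕ × ℕ in atTop,
      (∫ y, LU p.1 p.2 y ∂(P p.1 p.2) ≤ ∫ y, L p.1 p.2 y ∂(P p.1 p.2) + 2 * B p) ∧
      ∀ ε : ℝ, 0 < ε →
        P p.1 p.2 {y | L p.1 p.2 y + ε ≤ LU p.1 p.2 y} ≤ ENNReal.ofReal (2 / ε * B p) := by
    filter_upwards [hC, eventually_ge_atTop ((1, 1) : ℕ × ℕ)] with p hp hp1
    obtain ⟨r, c⟩ := p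
    have hr : 0 < r := hp1.1
    have hc : 0 < c := hp1.2
    obtain ⟨D, hDi, hDle, hD⟩ := hA r c (K r c) (η r c) hr hc
      (nonempty_obs_of_isEstimable (hK r c) hr hc) (cellMap_mulVec_cellMeans (hK r c) _ _ _)
      (hp.trans (le_max_left _ _))
    have hcmp := integral_le_of_abs_sub_le (hLU r c) (hL r c) hDi
      (fun y => (htU r c).isMinOn y ((ht r c).mem_range y))
      (fun y => hD y _ ((htU r c).mem_range y)) (fun y => hD y _ ((ht r c).mem_range y))
    refine ⟨hcmp.1.trans ?_, fun ε hε => (hcmp.2 ε hε).trans ?_⟩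
    · exact add_le_add le_rfl (mul_le_mul_of_nonneg_left hDle zero_le_two)
    · exact ENNReal.ofReal_le_ofReal (mul_le_mul_of_nonneg_left hDle (by positivity))
  refine ⟨fun ε hε => ?_, fun r c => ⟨hLU r c, hL r c⟩, fun ε hε => ?_⟩
  · have hlim : Tendsto (fun p => ENNReal.ofReal (2 / ε * B p)) atTop (𝓝 0) := by
      simpa using ENNReal.tendsto_ofReal (hB0.const_mul (2 / ε))
    exact tendsto_of_tendsto_of_tendsto_of_le_of_le' tendsto_const_nhds hlim
      (Eventually.of_forall fun _ => bot_le) (hmain.mono fun p hp => hp.2 ε hε)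
  · filter_upwards [hmain, hB0.eventually (gt_mem_nhds (show 0 < ε / 2 by linarith))] with p hp hpB
    linarith [hp.1]
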